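/- Let $V$ be a finite-dimensional real Euclidean space with inner product $\langle\cdot,\cdot\rangle$, let $\Phi\subset V$ be a (finite, reduced, not necessarily irreducible) crystallographic root system spanning $V$, of rank $n=\dim V$, with a simple system $S$ and the corresponding positive system $\Phi^+$. For $\alpha\in\Phi$ and an integer $r$ put $H_\alpha^r=\{x\in V\mid\langle x,\alpha\rangle=r\}$. For a positive integer $k$, the $k$-Catalan arrangement of $\Phi$ consists of the hyperplanes $H_\alpha^r$ with $\alpha\in\Phi$ and $r\in\{0,1,\ldots,k\}$; its regions are the connected components of the complement of the union of these hyperplanes, and a region $R$ is dominant if $\langle x,\alpha\rangle>0$ for all $x\in R$ and all $\alpha\in\Phi^+$. A wall of a dominant region $R$ is a hyperplane of the arrangement that supports a facet of $R$. A wall not containing the origin is a ceiling of $R$ if the origin lies on the same side of it as $R$, and a floor of $R$ if it separates $R$ from the origin. A hyperplane has height $r$ if it is of the form $H_\alpha^r$ with $\alpha\in\Phi^+$. Let $fl_r(l)$ be the number of dominant regions of the $k$-Catalan arrangement that have exactly $l$ floors of height $r$, and let $cl_r(l)$ be the number of dominant regions that have exactly $l$ ceilings of height $r$. Then $$fl_r(l)=cl_r(l)\qquad\text{for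 all } 1\le r\le k \text{ and } 0\le l\le n.$$ -/

import Mathlib

open scoped RealInnerProductSpace

namespace RootPairing

variable {ι V : Type*} [NormedAddCommGroup V] [InnerProductSpace ℝ V]

/-- A root pairing in a Euclidean space `V` is Euclidean if the pairing is the inner product of `V`
and the coroot of each root `α` is `2α / ⟪α, α⟫`. The reflection attached to `α` is then the
orthogonal reflection in the hyperplane perpendicular to `α`. -/
structure IsEuclidean (P : RootPairing ι ℝ V V) : Prop where
  toLinearMap_eq : P.toLinearMap = innerₗ V
  coroot_eq : ∀ i, P.coroot i = (2 / ⟪P.root i, P.root i⟫) • P.root i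

/-- The affine hyperplane `{x | ⟪x, α⟫ = r}`, where `α` is the root with index `i`. -/
def affineHyperplane (P : RootPairing ι ℝ V V) (i : ι) (r : ℕ) : AffineSubspace ℝ V where
  carrier := {x | ⟪x, P.root i⟫ = (r : ℝ)}
  smul_vsub_vadd_mem' := by
    intro c x y z hx hy hz
    simp only [Set.mem_ofPred_eq] at hx hy hz ⊢
    simp [inner_add_left, inner_sub_left, inner_smul_left, hx, hy, hz]

/-- The `k`-Catalan arrangement. -/
def catalanArrangement (P : RootPairing ι ℝ V V) (k : ℕ) : Set (AffineSubspace ℝ V) :=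
  {H | ∃ i : ι, ∃ r : ℕ, r ≤ k ∧ H = P.affineHyperplane i r}

/-- The complement in `V` of the union of the hyperplanes of the `k`-Catalan arrangement. -/
def catalanComplement (P : RootPairing ι ℝ V V) (k : ℕ) : Set V :=
  {x | ∀ H ∈ P.catalanArrangement k, x ∉ H}

/-- A region of the `k`-Catalan arrangement is a connected component of its complement. -/
def IsCatalanRegion (P : RootPairing ι ℝ V V) (k : ℕ) (R : Set V) : Prop :=
  ∃ x ∈ P.catalanComplement k, R = connectedComponentIn (P.catalanComplement k) x

/-- A hyperplane `H` of the `k`-Catalan arrangement is a wall of the region `R` if it supports a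
facet of `R`, that is, if the face `closure R ∩ H` of `closure R` has affine span `H`. -/
def IsCatalanWall (P : RootPairing ι ℝ V V) (k : ℕ) (R : Set V) (H : AffineSubspace ℝ V) : Prop :=
  H ∈ P.catalanArrangement k ∧ affineSpan ℝ (closure R ∩ (H : Set V)) = H

/-- A ceiling of `R` is a wall that does not contain the origin and has the origin on the same side
as `R`. -/
def IsCatalanCeiling (P : RootPairing ι ℝ V V) (k : ℕ) (R : Set V) (H : AffineSubspace ℝ V) :
    Prop :=
  P.IsCatalanWall k R H ∧ (0 : V) ∉ H ∧ ∀ x ∈ R, H.SSameSide 0 x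

/-- A floor of `R` is a wall that does not contain the origin and separates `R` from the origin. -/
def IsCatalanFloor (P : RootPairing ι ℝ V V) (k : ℕ) (R : Set V) (H : AffineSubspace ℝ V) : Prop :=
  P.IsCatalanWall k R H ∧ (0 : V) ∉ H ∧ ∀ x ∈ R, H.SOppSide 0 x

namespace Base

variable {P : RootPairing ι ℝ V V}

/-- The hyperplane `H` is of height `r` if it is `{x | ⟪x, α⟫ = r}` for a positive root `α`. -/
def HasHeight (b : P.Base) (r : ℕ) (H : AffineSubspace ℝ V) : Prop :=
  ∃ i : ι, b.IsPos i ∧ H = P.affineHyperplane i r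

/-- The dominant regions of the `k`-Catalan arrangement. -/
def IsDominantCatalanRegion (b : P.Base) (k : ℕ) (R : Set V) : Prop :=
  P.IsCatalanRegion k R ∧ ∀ i : ι, b.IsPos i → ∀ x ∈ R, 0 < ⟪x, P.root i⟫

/-- The number of dominant regions of the `k`-Catalan arrangement that have exactly `l` floors of
height `r`. -/
noncomputable def flCount (b : P.Base) (k r l : ℕ) : ℕ∞ :=
  {R : Set V | b.IsDominantCatalanRegion k R ∧
    {H | P.IsCatalanFloor k R H ∧ b.HasHeight r H}.encard = l}.encard

/-- The number of dominant regions of the `k`-Catalan arrangement that have exactly `l` ceilings of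
height `r`. -/
noncomputable def clCount (b : P.Base) (k r l : ℕ) : ℕ∞ :=
  {R : Set V | b.IsDominantCatalanRegion k R ∧
    {H | P.IsCatalanCeiling k R H ∧ b.HasHeight r H}.encard = l}.encard

end Base

end RootPairing

/-! Fix a set `M` of positive roots. As many dominant regions have all hyperplanes of height `r` of
roots in `M` among their floors as have all of them among their ceilings
(`encard_floor_eq_encard_ceiling`). Möbius inversion over supersets of `M` then shows that the set
of floors of height `r` and the set of ceilings of height `r` have the same distribution over the
dominant regions, and so do their sizes.

The equality for `M` comes from crossing all hyperplanes of `M` at once. Suppose these walls of `R`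
share a point `y` such that every arrangement hyperplane through `y` comes from a sum of the affine
roots `⟪·, α⟫ - r`, `α ∈ M` (`IsFacePoint`). Near `y` the walls in `M` alone cut out `R`, and the
opposite cone at `y` lies in a region with the same hyperplanes as walls, seen from the other side.
Which hyperplanes pass through `y` depends only on `M` and `r`, so the upper and the lower cell at
`y` determine each other (`upperCell_eq_iff`).

It remains to find `y`. Among the alcoves of the affine arrangement inside the region, take a lowest
one for floors, a highest one for ceilings. Reflecting it in one of its own walls on that side must
leave the region, so each such wall bounds the region (`exists_minimal_alcove`). Conversely, an
argument on sums of affine roots shows that each floor, respectively ceiling, in `M` is a wall of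
this single alcove (`isIndecomposable_of_isWallRoot`). Normals of alcove walls are at pairwise
non-acute angles; lying in an open half space they are independent, and projecting a point of the
alcove onto the intersection of the walls gives `y` (`exists_face_point`).

An unbounded region has no highest alcove. For ceilings the argument is therefore run in the
subsystem orthogonal to a vector `l`, and the resulting point is pushed far along `l`. -/

namespace AffineRoot

/-! ### Affine roots positive at a generic point, and the walls of its alcove. -/

variable {V : Type*} [NormedAddCommGroup V] [InnerProductSpace ℝ V]

/-- A finite reduced crystallographic set of vectors closed under the reflections it defines,
together with its closure under differences of vectors at acute angles. -/
structure IsRootSet (Ψ : Set V) : Prop where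
  finite : Ψ.Finite
  ne_zero : ∀ v ∈ Ψ, v ≠ 0
  neg_mem : ∀ v ∈ Ψ, -v ∈ Ψ
  sub_mem : ∀ u ∈ Ψ, ∀ v ∈ Ψ, 0 < ⟪u, v⟫ → u ≠ v → u - v ∈ Ψ
  exists_reflection : ∀ u ∈ Ψ, ∀ v ∈ Ψ, ∃ c : ℤ, 2 * ⟪u, v⟫ = c * ⟪v, v⟫ ∧ u - (c : ℝ) • v ∈ Ψ
  reduced : ∀ u ∈ Ψ, ∀ c : ℝ, c • u ∈ Ψ → c = 1 ∨ c = -1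

/-- The value at `x` of the affine function `y ↦ ⟪y, v⟫ + n` attached to the pair `(v, n)`. -/
noncomputable def eval (x : V) : V × ℤ →+ ℝ where
  toFun f := ⟪x, f.1⟫ + f.2
  map_zero' := by simp
  map_add' f g := by simp [inner_add_right]; ring

lemma eval_apply (x : V) (f : V × ℤ) : eval x f = ⟪x, f.1⟫ + f.2 := rfl

lemma eval_const (x : V) (c : ℤ) : eval x ((0 : V), c) = c := by simp [eval_apply]

/-- The affine roots that are positive at `x`. -/
def positive (Ψ : Set V) (x : V) : Set (V × ℤ) := {f | f.1 ∈ Ψ ∧ 0 < eval x f}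

/-- The point `x` lies on no hyperplane of the affine arrangement of `Ψ`. -/
def IsGeneric (Ψ : Set V) (x : V) : Prop := ∀ f : V × ℤ, f.1 ∈ Ψ → eval x f ≠ 0

/-- An affine root positive at `x` is indecomposable if it is neither the sum of two affine roots
positive at `x` nor the sum of such an affine root and the constant `1`. -/
structure IsIndecomposable (Ψ : Set V) (x : V) (τ : V × ℤ) : Prop where
  mem : τ ∈ positive Ψ x
  eval_le : eval x τ ≤ 1
  add_ne : ∀ f ∈ positive Ψ x, ∀ g ∈ positive Ψ x, f + g ≠ τ

variable {Ψ : Set V} {x : V}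

lemma IsRootSet.inner_self_pos (hΨ : IsRootSet Ψ) {v : V} (hv : v ∈ Ψ) : 0 < ⟪v, v⟫ :=
  real_inner_self_pos.mpr (hΨ.ne_zero v hv)

lemma neg_mem_positive (hΨ : IsRootSet Ψ) (hx : IsGeneric Ψ x) {f : V × ℤ} (hf : f.1 ∈ Ψ)
    (h : f ∉ positive Ψ x) : -f ∈ positive Ψ x := by
  refine ⟨hΨ.neg_mem _ hf, ?_⟩
  have h1 := hx f hf
  have h2 : ¬ 0 < eval x f := fun h' ↦ h ⟨hf, h'⟩
  rw [map_neg]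
  rcases lt_or_gt_of_ne h1 with h3 | h3
  · linarith
  · exact absurd h3 h2

lemma IsIndecomposable.sub_mem_positive (hΨ : IsRootSet Ψ) (hx : IsGeneric Ψ x) {τ f : V × ℤ}
    (hτ : IsIndecomposable Ψ x τ) (hf : f ∈ positive Ψ x) (h : 0 < ⟪f.1, τ.1⟫) (hne : f.1 ≠ τ.1) :
    f - τ ∈ positive Ψ x := by
  by_contra hc
  have := neg_mem_positive hΨ hx (hΨ.sub_mem _ hf.1 _ hτ.mem.1 h hne : (f - τ).1 ∈ Ψ) hc
  exact hτ.add_ne f hf _ this (by abel)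

/-- Distinct indecomposable affine roots make an obtuse or right angle. -/
lemma IsIndecomposable.inner_nonpos (hΨ : IsRootSet Ψ) (hx : IsGeneric Ψ x) {τ σ : V × ℤ}
    (hτ : IsIndecomposable Ψ x τ) (hσ : IsIndecomposable Ψ x σ) (hne : σ ≠ τ) :
    ⟪σ.1, τ.1⟫ ≤ 0 := by
  by_contra! h
  -- Parallel case: the values at `x` differ by a nonzero integer, yet both lie in `(0, 1]`.
  by_cases h1 : σ.1 = τ.1
  · have e : σ = τ + (0, σ.2 - τ.2) := by ext <;> simp [h1]
    have e' := congrArg (eval x) e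
    rw [map_add, eval_const] at e'
    have h2 : σ.2 - τ.2 ≠ 0 := fun h ↦ hne (by rw [e, h]; ext <;> simp)
    have a := hτ.mem.2
    have b := hσ.mem.2
    have c := hτ.eval_le
    have d := hσ.eval_le
    rcases lt_or_gt_of_ne h2 with h3 | h3
    · have : ((σ.2 - τ.2 : ℤ) : ℝ) ≤ -1 := by exact_mod_cast (by lia : σ.2 - τ.2 ≤ -1)
      linarith
    · have : (1 : ℝ) ≤ ((σ.2 - τ.2 : ℤ) : ℝ) := by exact_mod_cast h3
      linarith
  · have h2 := hτ.sub_mem_positive hΨ hx hσ.mem h h1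
    exact hσ.add_ne _ h2 _ hτ.mem (by abel)

lemma eval_reflection {x : V} {τ f : V × ℤ} {c : ℤ} (hτ : ⟪τ.1, τ.1⟫ ≠ 0)
    (hc : 2 * ⟪f.1, τ.1⟫ = c * ⟪τ.1, τ.1⟫) :
    eval (x - (2 * eval x τ / ⟪τ.1, τ.1⟫) • τ.1) f = eval x f - c * eval x τ := by
  have : ⟪τ.1, f.1⟫ = c * ⟪τ.1, τ.1⟫ / 2 := by rw [real_inner_comm]; linarith
  rw [eval_apply _ f, eval_apply _ f, inner_sub_left, inner_smul_left, this]
  simp only [conj_trivial]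
  field_simp
  ring

/-- This is positivity at `x` of the reflected affine root `f - cτ`. Strong induction on a bound for
the pairing number `c` avoids any classification of rank two systems: `f - τ` is again positive,
with pairing number `c - 2`. -/
lemma IsIndecomposable.mul_eval_lt (hΨ : IsRootSet Ψ) (hx : IsGeneric Ψ x) {τ : V × ℤ}
    (hτ : IsIndecomposable Ψ x τ) (N : ℕ) : ∀ c : ℤ, c ≤ N → ∀ f ∈ positive Ψ x, f.1 ≠ τ.1 →
      2 * ⟪f.1, τ.1⟫ = c * ⟪τ.1, τ.1⟫ → c * eval x τ < eval x f := by
  have hτ0 := hτ.mem.2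
  have hττ := hΨ.inner_self_pos hτ.mem.1
  induction N using Nat.strong_induction_on with
  | _ N ih =>
  intro c hcN f hf hne hc
  rcases le_or_gt c 0 with h0 | h0
  · have : (c : ℝ) ≤ 0 := by exact_mod_cast h0
    nlinarith [hf.2]
  -- The induction hypothesis for `g - τ` gives the claim short of one `τ`.
  have key : ∀ g ∈ positive Ψ x, g.1 ≠ τ.1 → 2 * ⟪g.1, τ.1⟫ = c * ⟪τ.1, τ.1⟫ →
      (c - 1) * eval x τ < eval x g := by
    intro g hg hgne hgc
    have hc' : (0 : ℝ) < c := by exact_mod_cast h0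
    have hgi : 0 < ⟪g.1, τ.1⟫ := by nlinarith [mul_pos hc' hττ]
    have hh := hτ.sub_mem_positive hΨ hx hg hgi hgne
    have hh1 : (g - τ).1 ≠ τ.1 := by
      intro h
      have h2 : g.1 = (2 : ℝ) • τ.1 := by
        rw [two_smul]; simpa [sub_eq_iff_eq_add] using h
      have := hΨ.reduced τ.1 hτ.mem.1 2 (h2 ▸ hg.1)
      norm_num at this
    have hh2 : 2 * ⟪(g - τ).1, τ.1⟫ = ((c - 2 : ℤ) : ℝ) * ⟪τ.1, τ.1⟫ := by
      simp only [Prod.fst_sub, inner_sub_left]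
      push_cast
      linarith
    have : ((c - 2 : ℤ) : ℝ) * eval x τ < eval x (g - τ) := by
      rcases Nat.eq_zero_or_pos N with hN | hN
      · lia
      · exact ih (N - 1) (by lia) (c - 2) (by lia) _ hh hh1 hh2
    rw [map_sub] at this
    push_cast at this
    linarith
  have hkf := key f hf hne hc
  rcases eq_or_lt_of_le (show 1 ≤ c from h0) with h1 | h1
  · have hfi : 0 < ⟪f.1, τ.1⟫ := by rw [← h1] at hc; push_cast at hc; linarith
    have := (hτ.sub_mem_positive hΨ hx hf hfi hne).2
    rw [map_sub] at this
    rw [← h1]; push_cast; linarith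
  -- `g` is minus the reflection of `f` in `τ` and has the same `c`. If the claim failed for `f`,
  -- then `g` would be positive at `x`, and `key` for both would give `(c - 1)τ < f < τ` at `x`,
  -- impossible for `c ≥ 2`.
  set g : V × ℤ := (((c : ℝ)) • τ.1 - f.1, c * τ.2 - f.2) with hg
  have hgΨ : g.1 ∈ Ψ := by
    obtain ⟨c', hc', hm⟩ := hΨ.exists_reflection f.1 hf.1 τ.1 hτ.mem.1
    have : (c' : ℝ) = c := by
      have : (c' : ℝ) * ⟪τ.1, τ.1⟫ = c * ⟪τ.1, τ.1⟫ := by linarith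
      exact mul_right_cancel₀ hττ.ne' this
    rw [this] at hm
    simpa [hg] using hΨ.neg_mem _ hm
  have hge : eval x g = c * eval x τ - eval x f := by
    simp only [hg, eval_apply, inner_sub_right, inner_smul_right]
    push_cast; ring
  by_contra! hle
  have hgp : g ∈ positive Ψ x := by
    refine ⟨hgΨ, lt_of_le_of_ne ?_ (hx g hgΨ).symm⟩
    rw [hge]; linarith
  have hgn : g.1 ≠ τ.1 := by
    intro h
    have h2 : f.1 = ((c : ℝ) - 1) • τ.1 := by
      have h' : (c : ℝ) • τ.1 - f.1 = τ.1 := h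
      rw [sub_smul, one_smul, sub_eq_iff_eq_add.mp h']; abel
    rcases hΨ.reduced τ.1 hτ.mem.1 _ (h2 ▸ hf.1) with h3 | h3
    · rw [h3, one_smul] at h2; exact hne h2
    · have : (c : ℝ) = 0 := by linarith
      have : c = 0 := by exact_mod_cast this
      lia
  have hkg := key g hgp hgn (by
    simp only [hg, inner_sub_left, inner_smul_left, conj_trivial]; linarith)
  have h1' : (2 : ℝ) ≤ c := by exact_mod_cast h1
  rw [hge] at hkg
  nlinarith

/-- Reflection in the hyperplane of an indecomposable affine root keeps the other positive
affine roots positive. -/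
lemma IsIndecomposable.eval_reflection_pos (hΨ : IsRootSet Ψ) (hx : IsGeneric Ψ x) {τ f : V × ℤ}
    (hτ : IsIndecomposable Ψ x τ) (hf : f ∈ positive Ψ x) (hne : f ≠ τ) :
    0 < eval (x - (2 * eval x τ / ⟪τ.1, τ.1⟫) • τ.1) f := by
  have hττ := hΨ.inner_self_pos hτ.mem.1
  obtain ⟨c, hc, -⟩ := hΨ.exists_reflection f.1 hf.1 τ.1 hτ.mem.1
  rw [eval_reflection hττ.ne' hc, sub_pos]
  by_cases h1 : f.1 = τ.1
  · have hc2 : (c : ℝ) = 2 := by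
      rw [h1] at hc; exact (mul_right_cancel₀ hττ.ne' hc).symm
    have e : f = τ + (0, f.2 - τ.2) := by ext <;> simp [h1]
    have e' := congrArg (eval x) e
    rw [map_add, eval_const] at e'
    have h2 : f.2 - τ.2 ≠ 0 := fun h ↦ hne (by rw [e, h]; ext <;> simp)
    have h3 := hτ.eval_le
    have h4 := hf.2
    rcases lt_or_gt_of_ne h2 with h | h
    · have : ((f.2 - τ.2 : ℤ) : ℝ) ≤ -1 := by exact_mod_cast (by lia : f.2 - τ.2 ≤ -1)
      linarith
    · have : (1 : ℝ) ≤ ((f.2 - τ.2 : ℤ) : ℝ) := by exact_mod_cast h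
      -- Here `f = τ + n` with `n ≥ 1` takes the value `n - τ(x)` at the reflected point, so `τ(x) <
      -- 1` must be strict; this is where genericity enters.
      have h5 : eval x τ ≠ 1 := by
        intro h6
        refine hx (τ - (0, 1)) (by simpa using hτ.mem.1) ?_
        rw [map_sub, eval_const, h6]; simp
      have := lt_of_le_of_ne h3 h5
      rw [e', hc2]; linarith
  · exact hτ.mul_eval_lt hΨ hx c.toNat c (by lia) f hf h1 hc

/-- Induction on affine roots positive at a generic point. -/
lemma positive_induction (hΨ : IsRootSet Ψ) (hx : IsGeneric Ψ x) {p : V × ℤ → Prop}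
    (indec : ∀ τ, IsIndecomposable Ψ x τ → p τ)
    (add : ∀ f ∈ positive Ψ x, ∀ g ∈ positive Ψ x, f.1 + g.1 ∈ Ψ → p f → p g → p (f + g))
    (succ : ∀ f ∈ positive Ψ x, p f → p (f + (0, 1))) {f : V × ℤ} (hf : f ∈ positive Ψ x) :
    p f := by
  -- Values of positive affine roots are bounded below by the least fractional part of `⟪x, v⟫` over
  -- the finite set `Ψ`. Each decomposition lowers the value by at least `ε`, so the induction
  -- terminates.
  obtain ⟨ε, hε, hmin⟩ : ∃ ε : ℝ, 0 < ε ∧ ∀ f ∈ positive Ψ x, ε ≤ eval x f := by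
    rcases Ψ.eq_empty_or_nonempty with he | hne
    · exact ⟨1, one_pos, fun f hf ↦ by simp [he, positive] at hf⟩
    obtain ⟨v, hv, hvmin⟩ := Set.exists_min_image Ψ (fun v ↦ Int.fract ⟪x, v⟫) hΨ.finite hne
    refine ⟨Int.fract ⟪x, v⟫, ?_, fun f hf ↦ (hvmin _ hf.1).trans ?_⟩
    · refine lt_of_le_of_ne (Int.fract_nonneg _) fun h ↦ hx (v, -⌊⟪x, v⟫⌋) hv ?_
      rw [eval_apply, h, Int.fract]; push_cast; ring
    · have h := hf.2
      have : 0 ≤ ⌊⟪x, f.1⟫⌋ + f.2 := by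
        rw [← Int.floor_add_intCast]; exact Int.floor_nonneg.mpr h.le
      have : (0 : ℝ) ≤ (⌊⟪x, f.1⟫⌋ : ℝ) + f.2 := by exact_mod_cast this
      rw [eval_apply, Int.fract]; linarith
  obtain ⟨N, hN⟩ := exists_nat_ge (eval x f / ε)
  rw [div_le_iff₀ hε] at hN
  induction N generalizing f with
  | zero => have := hf.2; simp at hN; linarith
  | succ N ih =>
    push_cast at hN
    by_cases h : IsIndecomposable Ψ x f
    · exact indec f h
    by_cases h1 : eval x f ≤ 1
    · obtain ⟨g, hg, h, hh, e⟩ : ∃ g ∈ positive Ψ x, ∃ h ∈ positive Ψ x, g + h = f := by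
        by_contra! hc; exact h ⟨hf, h1, hc⟩
      have a := hmin g hg
      have b := hmin h hh
      have c := congrArg (eval x) e
      rw [map_add] at c
      rw [← e]
      have hm : g.1 + h.1 ∈ Ψ := by rw [← Prod.fst_add, e]; exact hf.1
      exact add g hg h hh hm (ih hg (by linarith)) (ih hh (by linarith))
    · have hg : f - (0, 1) ∈ positive Ψ x := by
        refine ⟨by simpa using hf.1, ?_⟩
        rw [map_sub, eval_const]; push_cast; linarith
      -- Removing the constant `1` must also lower the value by at least `ε`; reducing `f` modulo
      -- `1` shows that it does.
      have hε1 : ε ≤ 1 := by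
        have := hmin _ hf
        by_contra! hε1
        have hv : (f.1, -⌊⟪x, f.1⟫⌋) ∈ positive Ψ x := by
          refine ⟨hf.1, lt_of_le_of_ne ?_ (hx (f.1, -⌊⟪x, f.1⟫⌋) hf.1).symm⟩
          rw [eval_apply]; push_cast; linarith [Int.floor_le ⟪x, f.1⟫]
        have h2 := hmin _ hv
        rw [eval_apply] at h2
        push_cast at h2
        linarith [Int.lt_floor_add_one ⟪x, f.1⟫]
      have := succ _ hg (ih hg (by rw [map_sub, eval_const]; push_cast; linarith))
      simpa using this

end AffineRoot

/-! ### Cofilters of affine roots and their wall roots. -/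

namespace AffineRoot

section IsSum

variable {V : Type*} [AddCommGroup V] {J : Set (V × ℤ)}

/-- Sums of finitely many, and at least one, elements of `J`. -/
def IsSum (J : Set (V × ℤ)) (f : V × ℤ) : Prop :=
  ∃ s : Multiset (V × ℤ), s ≠ 0 ∧ (∀ δ ∈ s, δ ∈ J) ∧ s.sum = f

namespace IsSum

lemma of_mem {f : V × ℤ} (hf : f ∈ J) : IsSum J f :=
  ⟨{f}, by simp, by simpa using hf, by simp⟩

lemma add {f g : V × ℤ} (hf : IsSum J f) (hg : IsSum J g) : IsSum J (f + g) := by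
  obtain ⟨s, hs, hsJ, rfl⟩ := hf
  obtain ⟨t, ht, htJ, rfl⟩ := hg
  refine ⟨s + t, by simp [hs], fun δ hδ ↦ ?_, by simp⟩
  rcases Multiset.mem_add.mp hδ with h | h
  exacts [hsJ δ h, htJ δ h]

lemma induction {p : V × ℤ → Prop} (mem : ∀ f ∈ J, p f) (add : ∀ f g, p f → p g → p (f + g))
    {f : V × ℤ} (hf : IsSum J f) : p f := by
  obtain ⟨s, hs, hsJ, rfl⟩ := hf
  induction s using Multiset.induction_on with
  | empty => exact absurd rfl hs
  | cons a t ih =>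
    have ha := mem a (hsJ a (by simp))
    rcases eq_or_ne t 0 with rfl | ht
    · simpa using ha
    · rw [Multiset.sum_cons]
      exact add _ _ ha (ih ht fun δ hδ ↦ hsJ δ (by simp [hδ]))

end IsSum

end IsSum

variable {V : Type*} [NormedAddCommGroup V] [InnerProductSpace ℝ V]

/-- The affine roots whose linear part is positive on `ξ`. -/
def halfSpace (Ψ : Set V) (ξ : V) : Set (V × ℤ) := {f | f.1 ∈ Ψ ∧ 0 < ⟪ξ, f.1⟫}

/-- A set `J` of affine roots in the half space of `ξ`, positive on `R`, stable under adding the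
constant `1`, and such that an element of `J` is never a sum of two affine roots of the half space
outside `J`. -/
structure IsCofilter (Ψ : Set V) (ξ : V) (R : Set V) (J : Set (V × ℤ)) : Prop where
  subset : J ⊆ halfSpace Ψ ξ
  add_one_mem : ∀ f ∈ J, f + (0, 1) ∈ J
  eval_pos : ∀ f ∈ J, ∀ z ∈ R, 0 < eval z f
  mem_or_mem : ∀ f ∈ halfSpace Ψ ξ, ∀ g ∈ halfSpace Ψ ξ, f + g ∈ J → f ∈ J ∨ g ∈ J

/-- An element of `J` whose hyperplane behaves as a wall of `R`. -/
structure IsWallRoot (Ψ : Set V) (ξ : V) (R : Set V) (J : Set (V × ℤ)) (m : V × ℤ) : Prop where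
  mem : m ∈ J
  exists_le : ∀ δ ∈ J, ∃ z ∈ R, eval z m ≤ eval z δ
  mem_of_add_mem : ∀ η ∈ halfSpace Ψ ξ, m + η ∈ J → η ∈ J

variable {Ψ : Set V} {ξ : V} {R : Set V} {J : Set (V × ℤ)}

namespace IsCofilter

lemma isSum_add_const (hJ : IsCofilter Ψ ξ R J) {f : V × ℤ} (hf : IsSum J f) (c : ℕ) :
    IsSum J (f + (0, (c : ℤ))) := by
  induction c with
  | zero => rwa [Nat.cast_zero, ← Prod.zero_eq_mk, add_zero]
  | succ c ih =>
    have key : ∀ {g}, IsSum J g → IsSum J (g + (0, 1)) := by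
      intro g hg
      refine IsSum.induction (p := fun g ↦ IsSum J g ∧ IsSum J (g + (0, 1)))
        (fun f hf ↦ ⟨.of_mem hf, .of_mem (hJ.add_one_mem f hf)⟩) (fun f g hf hg ↦ ?_) hg |>.2
      exact ⟨hf.1.add hg.1, by rw [add_assoc]; exact hf.1.add hg.2⟩
    convert key ih using 1
    rw [add_assoc]; simp

lemma isSum_of_le (hJ : IsCofilter Ψ ξ R J) {f g : V × ℤ} (hf : IsSum J f) (h1 : f.1 = g.1)
    (h2 : f.2 ≤ g.2) :
    IsSum J g := by
  convert hJ.isSum_add_const hf (g.2 - f.2).toNat using 1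
  ext
  · simp [h1]
  · simp [h2]

lemma inner_pos (hJ : IsCofilter Ψ ξ R J) {f : V × ℤ} (hf : IsSum J f) : 0 < ⟪ξ, f.1⟫ :=
  hf.induction (fun f hf ↦ (hJ.subset hf).2) fun f g hf hg ↦ by
    rw [Prod.fst_add, inner_add_right]; exact add_pos hf hg

lemma eval_isSum_pos (hJ : IsCofilter Ψ ξ R J) {f : V × ℤ} (hf : IsSum J f) {z : V}
    (hz : z ∈ R) : 0 < eval z f :=
  hf.induction (fun f hf ↦ hJ.eval_pos f hf z hz) fun f g hf hg ↦ by
    rw [map_add]; exact add_pos hf hg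

lemma exists_cons_of_inner_pos {s : Multiset (V × ℤ)} {v : V} (h : 0 < ⟪v, s.sum.1⟫) :
    ∃ δ t, s = δ ::ₘ t ∧ 0 < ⟪v, δ.1⟫ := by
  suffices ∃ δ ∈ s, 0 < ⟪v, δ.1⟫ by
    obtain ⟨δ, hδ, h'⟩ := this
    obtain ⟨t, rfl⟩ := Multiset.exists_cons_of_mem hδ
    exact ⟨δ, t, rfl, h'⟩
  by_contra! hc
  revert h
  rw [imp_false, not_lt]
  induction s using Multiset.induction_on with
  | empty => simp
  | cons a t ih =>
    rw [Multiset.sum_cons, Prod.fst_add, inner_add_right]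
    have := hc a (by simp)
    have := ih fun δ hδ ↦ hc δ (by simp [hδ])
    linarith

lemma mem_halfSpace_or (hΨ : IsRootSet Ψ) (hξ : ∀ v ∈ Ψ, ⟪ξ, v⟫ ≠ 0) {f : V × ℤ} (hf : f.1 ∈ Ψ) :
    f ∈ halfSpace Ψ ξ ∨ -f ∈ halfSpace Ψ ξ := by
  rcases lt_or_gt_of_ne (hξ _ hf) with h | h
  · exact Or.inr ⟨hΨ.neg_mem _ hf, by simpa using h⟩
  · exact Or.inl ⟨hf, h⟩

/-- If a sum of elements of `J` is a sum of two affine roots of the half space, one of these two is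
itself a sum of elements of `J`. -/
lemma isSum_or_isSum (hJ : IsCofilter Ψ ξ R J) (hΨ : IsRootSet Ψ) (hξ : ∀ v ∈ Ψ, ⟪ξ, v⟫ ≠ 0)
    {f g : V × ℤ} (hf : f ∈ halfSpace Ψ ξ) (hg : g ∈ halfSpace Ψ ξ) (hfg : f.1 + g.1 ∈ Ψ)
    (h : IsSum J (f + g)) : IsSum J f ∨ IsSum J g := by
  obtain ⟨s, hs, hsJ, e⟩ := h
  -- Induction on the number of summands: some summand `δ` makes an acute angle with `f + g`, hence
  -- with `f` or `g`, and is subtracted from that one.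
  induction hn : s.card generalizing s f g with
  | zero => exact absurd (Multiset.card_eq_zero.mp hn) hs
  | succ n ih =>
  have hpos : 0 < ⟪f.1 + g.1, s.sum.1⟫ := by rw [e]; exact hΨ.inner_self_pos hfg
  obtain ⟨δ, t, rfl, hδ⟩ := exists_cons_of_inner_pos hpos
  have hδJ : δ ∈ J := hsJ δ (by simp)
  have htJ : ∀ ε ∈ t, ε ∈ J := fun ε hε ↦ hsJ ε (by simp [hε])
  rw [Multiset.sum_cons] at e
  rcases eq_or_ne t 0 with rfl | ht
  · rw [Multiset.sum_zero, add_zero] at e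
    exact (hJ.mem_or_mem f hf g hg (e ▸ hδJ)).imp .of_mem .of_mem
  have htS : IsSum J t.sum := ⟨t, ht, htJ, rfl⟩
  have hne : f.1 + g.1 ≠ δ.1 := by
    intro h
    have h1 := hJ.inner_pos htS
    have h2 : t.sum.1 = 0 := by
      have := congrArg Prod.fst e
      rw [Prod.fst_add, Prod.fst_add, h] at this
      simpa using this
    rw [h2] at h1; simp at h1
  have hrt : f.1 + g.1 - δ.1 ∈ Ψ := hΨ.sub_mem _ hfg _ (hJ.subset hδJ).1 hδ hne
  have key : ∀ {f g : V × ℤ}, f ∈ halfSpace Ψ ξ → g ∈ halfSpace Ψ ξ → f.1 + g.1 - δ.1 ∈ Ψ →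
      δ + t.sum = f + g → 0 < ⟪f.1, δ.1⟫ → IsSum J f ∨ IsSum J g := by
    intro f g hf hg hrt e hfδ
    by_cases h1 : f.1 = δ.1
    · rcases le_or_gt δ.2 f.2 with h2 | h2
      · exact Or.inl (hJ.isSum_of_le (.of_mem hδJ) h1.symm h2)
      · refine Or.inr (hJ.isSum_of_le htS ?_ ?_)
        · have := congrArg Prod.fst e
          simp only [Prod.fst_add, h1] at this
          exact add_left_cancel this
        · have := congrArg Prod.snd e
          simp only [Prod.snd_add] at this
          lia
    have h2 : (f - δ).1 ∈ Ψ := hΨ.sub_mem _ hf.1 _ (hJ.subset hδJ).1 hfδ h1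
    rcases mem_halfSpace_or hΨ hξ h2 with h3 | h3
    · have e' : t.sum = f - δ + g := by rw [eq_sub_of_add_eq' e]; abel
      have h4 : (f - δ).1 + g.1 ∈ Ψ := by convert hrt using 1; simp; abel
      rcases ih h3 hg h4 t ht htJ e' (by simpa using hn) with h | h
      · left
        have := h.add (.of_mem hδJ)
        rwa [sub_add_cancel] at this
      · exact Or.inr h
    -- Now `δ = f + (δ - f)` splits in the half space, so `f` or `δ - f` is in `J`; in the second
    -- case `g` is `δ - f` plus the remaining summands.
    · rw [neg_sub] at h3
      have h4 : f + (δ - f) ∈ J := by rwa [add_sub_cancel]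
      refine (hJ.mem_or_mem f hf _ h3 h4).imp .of_mem fun h5 ↦ ?_
      have := htS.add (.of_mem h5)
      convert this using 1
      rw [eq_sub_of_add_eq' e]; abel
  rcases lt_or_ge 0 ⟪f.1, δ.1⟫ with h | h
  · exact key hf hg hrt e h
  · refine (key hg hf (by rwa [add_comm g.1]) (by rw [e, add_comm]) ?_).symm
    rw [inner_add_left] at hδ; linarith

/-- Pick a summand `δ` of `d`. At a point of `R` where `m ≤ δ`, the value of `d + h` strictly
exceeds that of `δ`, hence that of `m`. -/
lemma not_isWallRoot_of_eq (hJ : IsCofilter Ψ ξ R J) {m d h : V × ℤ} (hm : IsWallRoot Ψ ξ R J m)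
    (hd : IsSum J d) (hh : ∀ z ∈ R, 0 < eval z h) : d + h ≠ m := by
  intro e
  obtain ⟨s, hs, hsJ, rfl⟩ := hd
  obtain ⟨δ, hδ⟩ := Multiset.exists_mem_of_ne_zero hs
  obtain ⟨t, rfl⟩ := Multiset.exists_cons_of_mem hδ
  obtain ⟨z, hz, hle⟩ := hm.exists_le δ (hsJ δ hδ)
  have e' := congrArg (eval z) e
  rw [Multiset.sum_cons, map_add, map_add] at e'
  have h1 := hh z hz
  have h2 : 0 ≤ eval z t.sum := by
    rcases eq_or_ne t 0 with rfl | ht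
    · simp
    · exact (hJ.eval_isSum_pos ⟨t, ht, fun ε hε ↦ hsJ ε (by simp [hε]), rfl⟩ hz).le
  linarith

/-- Extends `mem_of_add_mem` from `J` to sums of its elements, which handles splittings of `m` with
one part outside the half space. The induction is that of `isSum_or_isSum`; the cases that would
make `m` a sum from `J` plus something positive on `R` are excluded by `not_isWallRoot_of_eq`. -/
lemma isSum_of_isWallRoot_add (hJ : IsCofilter Ψ ξ R J) (hΨ : IsRootSet Ψ)
    (hξ : ∀ v ∈ Ψ, ⟪ξ, v⟫ ≠ 0) {m η : V × ℤ} (hm : IsWallRoot Ψ ξ R J m) (hη : η ∈ halfSpace Ψ ξ)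
    (hmη : m.1 + η.1 ∈ Ψ) (h : IsSum J (m + η)) : IsSum J η := by
  obtain ⟨s, hs, hsJ, e⟩ := h
  have hmh := hJ.subset hm.mem
  induction hn : s.card generalizing s η with
  | zero => exact absurd (Multiset.card_eq_zero.mp hn) hs
  | succ n ih =>
  have hpos : 0 < ⟪m.1 + η.1, s.sum.1⟫ := by rw [e]; exact hΨ.inner_self_pos hmη
  obtain ⟨δ, t, rfl, hδ⟩ := exists_cons_of_inner_pos hpos
  have hδJ : δ ∈ J := hsJ δ (by simp)
  have htJ : ∀ ε ∈ t, ε ∈ J := fun ε hε ↦ hsJ ε (by simp [hε])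
  rw [Multiset.sum_cons] at e
  rcases eq_or_ne t 0 with rfl | ht
  · rw [Multiset.sum_zero, add_zero] at e
    exact .of_mem (hm.mem_of_add_mem η hη (e ▸ hδJ))
  have htS : IsSum J t.sum := ⟨t, ht, htJ, rfl⟩
  have e1 := congrArg Prod.fst e
  have e2 := congrArg Prod.snd e
  simp only [Prod.fst_add, Prod.snd_add] at e1 e2
  have hne : m.1 + η.1 ≠ δ.1 := by
    intro h
    have h1 := hJ.inner_pos htS
    have h2 : t.sum.1 = 0 := by rw [h] at e1; simpa using e1
    rw [h2] at h1; simp at h1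
  have hrt : m.1 + η.1 - δ.1 ∈ Ψ := hΨ.sub_mem _ hmη _ (hJ.subset hδJ).1 hδ hne
  rcases lt_or_ge 0 ⟪η.1, δ.1⟫ with hηδ | hηδ
  · by_cases h1 : η.1 = δ.1
    · rcases le_or_gt δ.2 η.2 with h2 | h2
      · exact hJ.isSum_of_le (.of_mem hδJ) h1.symm h2
      · refine absurd ?_ (hJ.not_isWallRoot_of_eq hm htS (h := (0, δ.2 - η.2)) fun z _ ↦ ?_)
        · have h3 : t.sum.1 = m.1 := by
            rw [h1, add_comm m.1] at e1; exact add_left_cancel e1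
          ext
          · simp [h3]
          · simp only [Prod.snd_add]; lia
        · rw [eval_const]; exact_mod_cast sub_pos.mpr h2
    have h2 : (η - δ).1 ∈ Ψ := hΨ.sub_mem _ hη.1 _ (hJ.subset hδJ).1 hηδ h1
    rcases mem_halfSpace_or hΨ hξ h2 with h3 | h3
    · have e' : t.sum = m + (η - δ) := by rw [eq_sub_of_add_eq' e]; abel
      have h4 : m.1 + (η - δ).1 ∈ Ψ := by convert hrt using 1; simp; abel
      have := (ih h3 h4 t ht htJ e' (by simpa using hn)).add (.of_mem hδJ)
      rwa [sub_add_cancel] at this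
    · rw [neg_sub] at h3
      have h4 : η + (δ - η) ∈ J := by rwa [add_sub_cancel]
      rcases hJ.mem_or_mem η hη _ h3 h4 with h5 | h5
      · exact .of_mem h5
      · refine absurd ?_ (hJ.not_isWallRoot_of_eq hm htS (hJ.eval_pos _ h5))
        rw [eq_sub_of_add_eq' e]; abel
  · have hmδ : 0 < ⟪m.1, δ.1⟫ := by rw [inner_add_left] at hδ; linarith
    by_cases h1 : m.1 = δ.1
    · rcases lt_or_ge δ.2 m.2 with h2 | h2
      · refine absurd ?_
          (hJ.not_isWallRoot_of_eq hm (.of_mem hδJ) (h := (0, m.2 - δ.2)) fun z _ ↦ ?_)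
        · ext <;> simp [h1]
        · rw [eval_const]; exact_mod_cast sub_pos.mpr h2
      · refine hJ.isSum_of_le htS ?_ (by lia)
        rw [h1] at e1; exact add_left_cancel e1
    have h2 : (m - δ).1 ∈ Ψ := hΨ.sub_mem _ hmh.1 _ (hJ.subset hδJ).1 hmδ h1
    rcases mem_halfSpace_or hΨ hξ h2 with h3 | h3
    · have e' : t.sum = m - δ + η := by rw [eq_sub_of_add_eq' e]; abel
      have h4 : (m - δ).1 + η.1 ∈ Ψ := by convert hrt using 1; simp; abel
      rcases hJ.isSum_or_isSum hΨ hξ h3 hη h4 (e' ▸ htS) with h5 | h5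
      · exact absurd (add_sub_cancel δ m) (hJ.not_isWallRoot_of_eq hm (.of_mem hδJ)
          fun z hz ↦ hJ.eval_isSum_pos h5 hz)
      · exact h5
    · rw [neg_sub] at h3
      have h4 := hm.mem_of_add_mem _ h3 (by rwa [add_sub_cancel])
      have := htS.add (.of_mem h4)
      convert this using 1
      rw [eq_sub_of_add_eq' e]; abel

/-- If all indecomposable affine roots at `x` in the half space belong to `J`, then the affine roots
of the half space that are positive at `x` are the sums of elements of `J`. -/
lemma isSum_of_mem_positive (hJ : IsCofilter Ψ ξ R J) (hΨ : IsRootSet Ψ)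
    (hξ : ∀ v ∈ Ψ, ⟪ξ, v⟫ ≠ 0) {x : V} (hx : IsGeneric Ψ x) (hxJ : ∀ f ∈ J, 0 < eval x f)
    (hD : ∀ τ, IsIndecomposable Ψ x τ → τ ∈ halfSpace Ψ ξ → τ ∈ J) {f : V × ℤ}
    (hf : f ∈ positive Ψ x) :
    (f ∈ halfSpace Ψ ξ → IsSum J f) ∧ (-f ∈ halfSpace Ψ ξ → ¬ IsSum J (-f)) := by
  have hpos : ∀ {f}, IsSum J f → 0 < eval x f := fun hf ↦
    hf.induction hxJ fun f g hf hg ↦ by rw [map_add]; exact add_pos hf hg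
  refine ⟨?_, fun _ h ↦ ?_⟩
  swap
  · have := hpos h
    rw [map_neg] at this
    linarith [hf.2]
  refine positive_induction hΨ hx (p := fun f ↦ f ∈ halfSpace Ψ ξ → IsSum J f)
    (fun τ hτ h ↦ .of_mem (hD τ hτ h)) (fun f hf g hg hfg ihf ihg h ↦ ?_)
    (fun f hf ih h ↦ ?_) hf
  · rcases mem_halfSpace_or hΨ hξ hf.1 with h1 | h1 <;>
      rcases mem_halfSpace_or hΨ hξ hg.1 with h2 | h2
    · exact (ihf h1).add (ihg h2)
    -- With `g` outside the half space, `f` splits as `(f + g) + (-g)`, and `-g`, being negative at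
    -- `x`, is not a sum from `J`.
    · have e : f + g + -g = f := by abel
      refine (hJ.isSum_or_isSum hΨ hξ h h2 ?_ (e.symm ▸ ihf h1)).resolve_right fun h3 ↦ ?_
      · simpa using hf.1
      · have := hpos h3
        rw [map_neg] at this
        linarith [hg.2]
    · have e : f + g + -f = g := by abel
      refine (hJ.isSum_or_isSum hΨ hξ h h1 ?_ (e.symm ▸ ihg h2)).resolve_right fun h3 ↦ ?_
      · simpa using hg.1
      · have := hpos h3
        rw [map_neg] at this
        linarith [hf.2]
    · have a := h.2
      have b := h1.2
      have c := h2.2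
      simp only [Prod.fst_add, Prod.fst_neg, inner_add_right, inner_neg_right] at a b c
      linarith
  · exact hJ.isSum_add_const (ih ⟨hf.1, by simpa using h.2⟩) 1

/-- By `isSum_of_mem_positive`, a half-space affine root is positive at `x` exactly when it is a sum
from `J`. So minimality of `m` on `R` forbids a splitting `m = f + g` inside the half space. If `-g`
is in the half space, then `m + (-g) = f` is a sum from `J`, hence so is `-g`, contradicting
positivity of `g` at `x`. -/
lemma isIndecomposable_of_isWallRoot (hJ : IsCofilter Ψ ξ R J) (hΨ : IsRootSet Ψ)
    (hξ : ∀ v ∈ Ψ, ⟪ξ, v⟫ ≠ 0) {x : V} (hx : IsGeneric Ψ x) (hxJ : ∀ f ∈ J, 0 < eval x f)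
    (hD : ∀ τ, IsIndecomposable Ψ x τ → τ ∈ halfSpace Ψ ξ → τ ∈ J) {m : V × ℤ}
    (hm : IsWallRoot Ψ ξ R J m) : IsIndecomposable Ψ x m := by
  have hmh := hJ.subset hm.mem
  have hT := fun {f} ↦ hJ.isSum_of_mem_positive hΨ hξ hx hxJ hD (f := f)
  refine ⟨⟨hmh.1, hxJ m hm.mem⟩, ?_, fun f hf g hg e ↦ ?_⟩
  · by_contra! h
    have h1 : m - (0, 1) ∈ positive Ψ x := by
      refine ⟨by simpa using hmh.1, ?_⟩
      rw [map_sub, eval_const]; push_cast; linarith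
    have h2 := (hT h1).1 ⟨by simpa using hmh.1, by simpa using hmh.2⟩
    refine hJ.not_isWallRoot_of_eq hm h2 (h := (0, 1)) (fun z _ ↦ ?_) (by simp)
    rw [eval_const]; simp
  · have key : ∀ {f g}, f ∈ positive Ψ x → g ∈ positive Ψ x → f + g = m → f ∈ halfSpace Ψ ξ →
        -g ∈ halfSpace Ψ ξ → False := by
      intro f g hf hg e h1 h2
      have e' : m + -g = f := by rw [← e]; abel
      refine (hT hg).2 h2 (hJ.isSum_of_isWallRoot_add hΨ hξ hm h2 ?_ (e'.symm ▸ (hT hf).1 h1))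
      rw [← Prod.fst_add, e']; exact hf.1
    rcases mem_halfSpace_or hΨ hξ hf.1 with h1 | h1 <;>
      rcases mem_halfSpace_or hΨ hξ hg.1 with h2 | h2
    · exact hJ.not_isWallRoot_of_eq hm ((hT hf).1 h1)
        (fun z hz ↦ hJ.eval_isSum_pos ((hT hg).1 h2) hz) e
    · exact key hf hg e h1 h2
    · exact key hg hf (by rw [add_comm, e]) h2 h1
    · have a := hmh.2
      have b := h1.2
      have c := h2.2
      rw [← e] at a
      simp only [Prod.fst_add, Prod.fst_neg, inner_add_right, inner_neg_right] at a b c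
      linarith

end IsCofilter

end AffineRoot

/-! ### Obtuse families of vectors, faces of alcoves, and extremal alcoves. -/

namespace AffineRoot

variable {V : Type*} [NormedAddCommGroup V] [InnerProductSpace ℝ V]

lemma exists_sum_inner_eq {κ : Type*} [Fintype κ] {a : κ → V} (ha : LinearIndependent ℝ a)
    (c : κ → ℝ) : ∃ d : κ → ℝ, ∀ i, ⟪∑ j, d j • a j, a i⟫ = c i := by
  let L : (κ → ℝ) →ₗ[ℝ] (κ → ℝ) :=
    { toFun := fun d i ↦ ⟪∑ j, d j • a j, a i⟫
      map_add' := fun d e ↦ by ext i; simp [add_smul, Finset.sum_add_distrib, inner_add_left]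
      map_smul' := fun r d ↦ by
        ext i; simp [mul_smul, ← Finset.smul_sum, inner_smul_left] }
  have hL : Function.Injective L := by
    rw [← LinearMap.ker_eq_bot, LinearMap.ker_eq_bot']
    intro d hd
    have h0 : ∑ j, d j • a j = 0 := by
      rw [← inner_self_eq_zero (𝕜 := ℝ)]
      conv_lhs => rw [inner_sum]
      refine Finset.sum_eq_zero fun i _ ↦ ?_
      have : ⟪∑ j, d j • a j, a i⟫ = 0 := congrFun hd i
      rw [inner_smul_right, this, mul_zero]
    exact funext (Fintype.linearIndependent_iff.mp ha d h0)
  obtain ⟨d, hd⟩ := LinearMap.injective_iff_surjective.mp hL c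
  exact ⟨d, fun i ↦ congrFun hd i⟩

lemma exists_inner_eq {κ : Type*} [Fintype κ] {a : κ → V} (ha : LinearIndependent ℝ a)
    (c : κ → ℝ) : ∃ u : V, ∀ i, ⟪u, a i⟫ = c i :=
  let ⟨_, hd⟩ := exists_sum_inner_eq ha c
  ⟨_, hd⟩

/-- Vectors of an open half space at pairwise obtuse or right angles are linearly independent. -/
lemma linearIndependent_of_inner_nonpos {κ : Type*} {a : κ → V} {ξ : V}
    (hpos : ∀ i, 0 < ⟪ξ, a i⟫) (hobt : Pairwise fun i j ↦ ⟪a i, a j⟫ ≤ 0) :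
    LinearIndependent ℝ a := by
  refine LinearMap.BilinForm.linearIndependent_of_pairwise_le_zero (innerₗ V) ?_ (innerₗ V ξ) a
    hpos hobt
  intro v hv
  simpa using pow_pos (norm_pos_iff.mpr hv) 2

/-- The inverse Gram matrix of linearly independent vectors at pairwise obtuse or right angles has
nonnegative entries. -/
lemma nonneg_of_inner_nonpos {κ : Type*} [Fintype κ] {a : κ → V} (ha : LinearIndependent ℝ a)
    (hobt : Pairwise fun i j ↦ ⟪a i, a j⟫ ≤ 0) {d : κ → ℝ}
    (hd : ∀ i, 0 ≤ ⟪∑ j, d j • a j, a i⟫) (i : κ) : 0 ≤ d i := by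
  -- The combination is `p - q` with `⟪p - q, q⟫ ≥ 0` and `⟪p, q⟫ ≤ 0`, which forces `q = 0`.
  set p := ∑ j, (d j)⁺ • a j with hp
  set q := ∑ j, (d j)⁻ • a j with hq
  have hdpq : ∑ j, d j • a j = p - q := by
    rw [hp, hq, ← Finset.sum_sub_distrib]
    refine Finset.sum_congr rfl fun j _ ↦ ?_
    rw [← sub_smul, posPart_sub_negPart]
  have h1 : 0 ≤ ⟪p - q, q⟫ := by
    rw [← hdpq]
    conv_rhs => rw [hq, inner_sum]
    exact Finset.sum_nonneg fun j _ ↦ by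
      rw [inner_smul_right]; exact mul_nonneg (negPart_nonneg _) (hd j)
  have h2 : ⟪p, q⟫ ≤ 0 := by
    rw [hp, hq, sum_inner]
    refine Finset.sum_nonpos fun j _ ↦ ?_
    rw [inner_sum]
    refine Finset.sum_nonpos fun l _ ↦ ?_
    rw [inner_smul_left, inner_smul_right, conj_trivial]
    rcases eq_or_ne j l with rfl | hjl
    · rcases le_total 0 (d j) with h | h
      · simp [negPart_eq_zero.mpr h]
      · simp [posPart_eq_zero.mpr h]
    · exact mul_nonpos_of_nonneg_of_nonpos (posPart_nonneg _)
        (mul_nonpos_of_nonneg_of_nonpos (negPart_nonneg _) (hobt hjl))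
  have h3 : q = 0 := by
    rw [← inner_self_eq_zero (𝕜 := ℝ)]
    rw [inner_sub_left] at h1
    exact le_antisymm (by linarith) real_inner_self_nonneg
  exact negPart_eq_zero.mp (Fintype.linearIndependent_iff.mp ha _ h3 i)

variable {Ψ : Set V} {x ξ : V}

/-- The face of the alcove of `x` cut out by some of its walls has a point that lies on no other
wall. -/
lemma exists_face_point (hΨ : IsRootSet Ψ) (hx : IsGeneric Ψ x) {κ : Type*} [Fintype κ]
    {m : κ → V × ℤ} (hm : ∀ i, IsIndecomposable Ψ x (m i)) (hinj : Function.Injective m)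
    (hξ : ∀ i, 0 < ⟪ξ, (m i).1⟫) :
    LinearIndependent ℝ (fun i ↦ (m i).1) ∧ ∃ y, (∀ i, eval y (m i) = 0) ∧
      ∀ f ∈ positive Ψ x, 0 ≤ eval y f ∧
        (eval y f = 0 → f ∈ AddSubmonoid.closure (Set.range m)) := by
  have hobt : Pairwise fun i j ↦ ⟪(m i).1, (m j).1⟫ ≤ 0 := fun i j hij ↦
    (hm j).inner_nonpos hΨ hx (hm i) (hinj.ne hij)
  have hli : LinearIndependent ℝ (fun i ↦ (m i).1) := linearIndependent_of_inner_nonpos hξ hobt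
  -- `x - ∑ d_j m_j` is the orthogonal projection of `x` onto the intersection of the chosen walls.
  -- Since `d ≥ 0` and the angles are not acute, the values of the other indecomposable roots do not
  -- decrease.
  obtain ⟨d, hd⟩ := exists_sum_inner_eq hli fun i ↦ eval x (m i)
  have hd0 := nonneg_of_inner_nonpos hli hobt fun i ↦ (hd i).symm ▸ (hm i).mem.2.le
  have hev : ∀ f, eval (x - ∑ j, d j • (m j).1) f = eval x f - ⟪∑ j, d j • (m j).1, f.1⟫ := by
    intro f
    simp only [eval_apply, inner_sub_left]; ring
  refine ⟨hli, x - ∑ j, d j • (m j).1, fun i ↦ by rw [hev, hd, sub_self], fun f hf ↦ ?_⟩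
  refine positive_induction hΨ hx (p := fun f ↦ 0 ≤ eval (x - ∑ j, d j • (m j).1) f ∧
      (eval (x - ∑ j, d j • (m j).1) f = 0 → f ∈ AddSubmonoid.closure (Set.range m)))
    (fun τ hτ ↦ ?_) (fun f _ g _ _ ihf ihg ↦ ?_) (fun f _ ih ↦ ?_) hf
  · by_cases h : τ ∈ Set.range m
    · refine ⟨?_, fun _ ↦ AddSubmonoid.subset_closure h⟩
      obtain ⟨i, rfl⟩ := h
      rw [hev, hd, sub_self]
    · have h1 : ⟪∑ j, d j • (m j).1, τ.1⟫ ≤ 0 := by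
        rw [sum_inner]
        refine Finset.sum_nonpos fun j _ ↦ ?_
        rw [inner_smul_left, conj_trivial]
        exact mul_nonpos_of_nonneg_of_nonpos (hd0 j)
          (hτ.inner_nonpos hΨ hx (hm j) fun e ↦ h ⟨j, e⟩)
      have h2 := hτ.mem.2
      rw [hev]
      exact ⟨by linarith, fun h3 ↦ by linarith⟩
  · rw [map_add]
    refine ⟨add_nonneg ihf.1 ihg.1, fun h ↦ ?_⟩
    have a := ihf.1
    have b := ihg.1
    exact add_mem (ihf.2 (by linarith)) (ihg.2 (by linarith))
  · rw [map_add, eval_const]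
    have := ih.1
    push_cast
    exact ⟨by linarith, fun h ↦ by linarith⟩

/-- Baire category: the affine roots are countably many, and each is nonzero on a dense open set. -/
lemma exists_isGeneric [FiniteDimensional ℝ V] (hΨ : IsRootSet Ψ) {R : Set V} (hR : IsOpen R)
    (hne : R.Nonempty) : ∃ x ∈ R, IsGeneric Ψ x := by
  have : Countable {f : V × ℤ // f.1 ∈ Ψ} := by
    have := hΨ.finite.countable.to_subtype
    refine Function.Injective.countable (β := Ψ × ℤ) (f := fun f ↦ (⟨f.1.1, f.2⟩, f.1.2)) ?_
    rintro ⟨⟨a, b⟩, _⟩ ⟨⟨c, d⟩, _⟩ h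
    simpa using h
  have hd : Dense (⋂ f : {f : V × ℤ // f.1 ∈ Ψ}, {x : V | eval x f.1 ≠ 0}) := by
    have : CompleteSpace V := FiniteDimensional.complete ℝ V
    refine dense_iInter_of_isOpen (fun f ↦ ?_) fun f x ↦ ?_
    · refine isOpen_ne_fun ?_ continuous_const
      simp only [eval_apply]
      fun_prop
    · by_cases h : eval x f.1 = 0
      · have ht : Filter.Tendsto (fun n : ℕ ↦ x + (1 / ((n : ℝ) + 1)) • f.1.1) Filter.atTop
            (nhds (x + (0 : ℝ) • f.1.1)) :=
          tendsto_const_nhds.add (tendsto_one_div_add_atTop_nhds_zero_nat.smul_const _)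
        rw [zero_smul, add_zero] at ht
        refine mem_closure_of_tendsto ht (Filter.Eventually.of_forall fun n ↦ ?_)
        have e : eval (x + (1 / ((n : ℝ) + 1)) • f.1.1) f.1 =
            eval x f.1 + 1 / ((n : ℝ) + 1) * ⟪f.1.1, f.1.1⟫ := by
          simp only [eval_apply, inner_add_left, inner_smul_left, conj_trivial]; ring
        rw [Set.mem_ofPred_eq, e, h, zero_add]
        have := hΨ.inner_self_pos f.2
        positivity
      · exact subset_closure h
  obtain ⟨x, hx, hxR⟩ := hd.inter_open_nonempty R hR hne
  rw [Set.mem_iInter] at hxR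
  exact ⟨x, hx, fun f hf ↦ hxR ⟨f, hf⟩⟩

/-- The points on the same side as `R` of every hyperplane `{x | ⟪x, v⟫ + n = 0}` with `v ∈ Ψ` and
`|n| ≤ k` that does not meet `R`. -/
def truncation (Ψ : Set V) (k : ℕ) (R : Set V) : Set V :=
  {x | ∀ f : V × ℤ, f.1 ∈ Ψ → |f.2| ≤ k → (∀ z ∈ R, 0 < eval z f) → 0 < eval x f}

/-- There is an alcove in the truncation of `R` all of whose walls in the half space of `ξ` bound
the truncation. -/
lemma exists_minimal_alcove [FiniteDimensional ℝ V] (hΨ : IsRootSet Ψ) {k : ℕ} {R : Set V}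
    (hR : IsOpen R) (hne : R.Nonempty) {B : V → ℝ}
    (hB : ∀ x ∈ truncation Ψ k R, ∀ v ∈ Ψ, 0 < ⟪ξ, v⟫ → B v ≤ ⟪x, v⟫) :
    ∃ x ∈ truncation Ψ k R, IsGeneric Ψ x ∧ ∀ τ, IsIndecomposable Ψ x τ → τ ∈ halfSpace Ψ ξ →
      |τ.2| ≤ k ∧ ∀ z ∈ R, 0 < eval z τ := by
  classical
  let S : Finset V := hΨ.finite.toFinset.filter fun v ↦ 0 < ⟪ξ, v⟫
  -- Total height of the alcove of `x` above the bound `B` in the half-space directions; on the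
  -- truncation `hB` makes each difference nonnegative, so `toNat` loses nothing.
  let L : V → ℕ := fun x ↦ ∑ v ∈ S, (⌊⟪x, v⟫⌋ - ⌊B v⌋).toNat
  obtain ⟨x₀, hx₀R, hx₀⟩ := exists_isGeneric hΨ hR hne
  obtain ⟨x, ⟨hxR, hx⟩, hmin⟩ := (measure L).wf.has_min
    {x | x ∈ truncation Ψ k R ∧ IsGeneric Ψ x} ⟨x₀, fun f _ _ h ↦ h x₀ hx₀R, hx₀⟩
  refine ⟨x, hxR, hx, fun τ hτ hτξ ↦ ?_⟩
  -- Reflection in the wall `τ`: among the affine roots positive at `x` only `τ` changes sign. If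
  -- `x'` stayed in the truncation, `L` would drop; so a constraint of the truncation fails at `x'`,
  -- and it must be `τ`.
  set x' := x - (2 * eval x τ / ⟪τ.1, τ.1⟫) • τ.1 with hx'
  have hpos : ∀ f ∈ positive Ψ x, f ≠ τ → 0 < eval x' f := fun f hf hne ↦
    hτ.eval_reflection_pos hΨ hx hf hne
  have hττ := hΨ.inner_self_pos hτ.mem.1
  have hneg : eval x' τ = -eval x τ := by
    rw [hx', eval_reflection (c := 2) hττ.ne' (by norm_num)]; push_cast; ring
  have hτ0 := hτ.mem.2
  have hgen : IsGeneric Ψ x' := by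
    intro f hf
    by_cases h1 : f = τ
    · rw [h1, hneg]; linarith
    by_cases h2 : -f = τ
    · rw [← neg_neg f, map_neg, h2, hneg]; linarith
    by_cases h3 : f ∈ positive Ψ x
    · exact (hpos f h3 h1).ne'
    · have := hpos _ (neg_mem_positive hΨ hx hf h3) h2
      rw [map_neg] at this
      linarith
  have hfloor : ∀ v ∈ S, ⌊⟪x', v⟫⌋ ≤ ⌊⟪x, v⟫⌋ := by
    intro v hv
    obtain ⟨hvΨ, hvξ⟩ : v ∈ Ψ ∧ 0 < ⟪ξ, v⟫ := by simpa [S] using hv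
    rw [Int.le_floor]
    by_contra! hlt
    -- A growing floor would give an affine root with linear part `-v` positive at `x` but not at
    -- `x'`, hence equal to `τ`, although `τ` lies in the half space and `-v` does not.
    have h1 : -((v, -⌊⟪x', v⟫⌋) : V × ℤ) ∈ positive Ψ x := by
      refine ⟨by simpa using hΨ.neg_mem _ hvΨ, ?_⟩
      rw [map_neg, eval_apply]; push_cast; linarith
    have h2 : -((v, -⌊⟪x', v⟫⌋) : V × ℤ) ≠ τ := by
      intro h
      have := hτξ.2
      rw [← h] at this
      simp at this
      linarith
    have h3 := hpos _ h1 h2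
    rw [map_neg, eval_apply] at h3
    push_cast at h3
    linarith [Int.floor_le ⟪x', v⟫]
  have hτS : τ.1 ∈ S := by simpa [S] using And.intro hτξ.1 hτξ.2
  have hlt : x' ∈ truncation Ψ k R → L x' < L x := by
    intro hxt
    refine Finset.sum_lt_sum (fun v hv ↦ ?_) ⟨τ.1, hτS, ?_⟩
    · have := hfloor v hv
      lia
    · have h1 : ⌊⟪x', τ.1⟫⌋ < -τ.2 := by
        rw [Int.floor_lt]
        rw [eval_apply] at hneg
        push_cast; linarith
      have h2 : -τ.2 ≤ ⌊⟪x, τ.1⟫⌋ := by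
        rw [Int.le_floor]
        rw [eval_apply] at hτ0
        push_cast; linarith
      have h3 : ⌊B τ.1⌋ ≤ ⌊⟪x', τ.1⟫⌋ := Int.floor_le_floor (hB x' hxt _ hτξ.1 hτξ.2)
      lia
  have hnot : x' ∉ truncation Ψ k R := fun h ↦ hmin x' ⟨h, hgen⟩ (hlt h)
  simp only [truncation, Set.mem_ofPred_eq, not_forall] at hnot
  obtain ⟨f, hfΨ, hfk, hfR, hf⟩ := hnot
  have hfp : f ∈ positive Ψ x := ⟨hfΨ, hxR f hfΨ hfk hfR⟩
  have : f = τ := by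
    by_contra h
    exact hf (hpos f hfp h)
  exact this ▸ ⟨hfk, hfR⟩

end AffineRoot

/-! ### From geometric walls to a common face point. -/

namespace AffineRoot

variable {V : Type*} [NormedAddCommGroup V] [InnerProductSpace ℝ V]

lemma continuous_eval (f : V × ℤ) : Continuous fun x ↦ eval x f := by
  simp only [eval_apply]
  fun_prop

/-- The affine hyperplane on which the affine function of `f` vanishes. -/
def zeroSet (f : V × ℤ) : AffineSubspace ℝ V where
  carrier := {x | eval x f = 0}
  smul_vsub_vadd_mem' := by
    intro c x y z hx hy hz
    simp only [Set.mem_ofPred_eq, eval_apply] at hx hy hz ⊢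
    simp only [vsub_eq_sub, vadd_eq_add, inner_add_left, inner_smul_left, inner_sub_left,
      conj_trivial]
    linear_combination c * (hx - hy) + hz

lemma mem_zeroSet {f : V × ℤ} {x : V} : x ∈ zeroSet f ↔ eval x f = 0 := Iff.rfl

variable {Ψ : Set V} {ξ : V} {R : Set V}

/-- No affine root is positive on `R` and smaller on `R` than the affine root of a wall of `R`. -/
lemma exists_eval_le_of_wall (hΨ : IsRootSet Ψ) {m f : V × ℤ} (hm : m ∈ halfSpace Ψ ξ)
    (hf : f ∈ halfSpace Ψ ξ) (hne : R.Nonempty)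
    (hspan : zeroSet m ≤ affineSpan ℝ (closure R ∩ {z | eval z m = 0}))
    (hpos : ∀ z ∈ R, 0 < eval z f) : ∃ z ∈ R, eval z m ≤ eval z f := by
  -- If `f < m` throughout `R`, then `0 ≤ f ≤ m` on the closure, so `f` vanishes on the face and on
  -- its span, the hyperplane of `m`. Reducedness leaves `f = m`, absurd, or opposite linear parts,
  -- excluded by the half space.
  by_contra! hlt
  have hcl : ∀ z ∈ closure R, 0 ≤ eval z f ∧ eval z f ≤ eval z m := by
    intro z hz
    have h1 : IsClosed {z : V | 0 ≤ eval z f ∧ eval z f ≤ eval z m} :=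
      (isClosed_le continuous_const (continuous_eval f)).inter
        (isClosed_le (continuous_eval f) (continuous_eval m))
    exact closure_minimal (t := {z : V | 0 ≤ eval z f ∧ eval z f ≤ eval z m})
      (fun z hz ↦ ⟨(hpos z hz).le, (hlt z hz).le⟩) h1 hz
  have hle : zeroSet m ≤ zeroSet f := by
    refine hspan.trans (affineSpan_le.mpr fun z hz ↦ ?_)
    have h1 := hcl z hz.1
    have h2 : eval z m = 0 := hz.2
    exact le_antisymm (h1.2.trans h2.le) h1.1
  have hmm := hΨ.inner_self_pos hm.1
  have hp : ∀ w : V, ⟪w, m.1⟫ = 0 →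
      (-(m.2 : ℝ) / ⟪m.1, m.1⟫) • m.1 + w ∈ zeroSet f := by
    intro w hw
    refine hle (mem_zeroSet.mpr ?_)
    rw [eval_apply, inner_add_left, inner_smul_left, hw, conj_trivial]
    field_simp
    ring
  have hperp : ∀ w : V, ⟪w, m.1⟫ = 0 → ⟪w, f.1⟫ = 0 := by
    intro w hw
    have h1 := mem_zeroSet.mp (hp w hw)
    have h0 := mem_zeroSet.mp (hp 0 (by simp))
    rw [eval_apply, inner_add_left] at h0 h1
    rw [inner_zero_left] at h0
    linarith
  set c := ⟪f.1, m.1⟫ / ⟪m.1, m.1⟫ with hc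
  have hfc : f.1 = c • m.1 := by
    have h1 : ⟪f.1 - c • m.1, m.1⟫ = 0 := by
      rw [inner_sub_left, inner_smul_left, conj_trivial, hc]
      field_simp
      ring
    have h2 := hperp _ h1
    have h3 : ⟪f.1 - c • m.1, f.1 - c • m.1⟫ = 0 := by
      rw [inner_sub_right, inner_smul_right, h1, h2]; simp
    exact sub_eq_zero.mp (inner_self_eq_zero.mp h3)
  rcases hΨ.reduced m.1 hm.1 c (hfc ▸ hf.1) with h1 | h1
  · rw [h1, one_smul] at hfc
    obtain ⟨z, hz⟩ := hne
    have h0 := mem_zeroSet.mp (hp 0 (by simp))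
    rw [add_zero, eval_apply, hfc, inner_smul_left, conj_trivial] at h0
    have h3 : (f.2 : ℝ) = m.2 := by
      field_simp at h0
      linarith
    have h4 := hlt z hz
    rw [eval_apply, eval_apply, hfc, h3] at h4
    exact lt_irrefl _ h4
  · have h2 := hf.2
    have h3 := hm.2
    rw [hfc, h1, inner_smul_right] at h2
    linarith

/-- The walls of `R` belonging to a cofilter that contains all affine roots of level at most `k`
positive on `R` meet in a face of the truncation of `R` that lies on no other wall. -/
lemma IsCofilter.exists_face_point [FiniteDimensional ℝ V] (hΨ : IsRootSet Ψ)
    (hξ : ∀ v ∈ Ψ, ⟪ξ, v⟫ ≠ 0) {k : ℕ} (hR : IsOpen R) (hne : R.Nonempty) {B : V → ℝ}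
    (hB : ∀ x ∈ truncation Ψ k R, ∀ v ∈ Ψ, 0 < ⟪ξ, v⟫ → B v ≤ ⟪x, v⟫)
    {J : Set (V × ℤ)} (hJ : IsCofilter Ψ ξ R J)
    (hmem : ∀ f ∈ halfSpace Ψ ξ, |f.2| ≤ k → (∀ z ∈ R, 0 < eval z f) → f ∈ J)
    (hpos : ∀ x ∈ truncation Ψ k R, ∀ f ∈ J, 0 < eval x f)
    {κ : Type*} [Fintype κ] {m : κ → V × ℤ} (hm : ∀ i, IsWallRoot Ψ ξ R J (m i))
    (hinj : Function.Injective m) :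
    LinearIndependent ℝ (fun i ↦ (m i).1) ∧ ∃ y, (∀ i, eval y (m i) = 0) ∧
      ∀ f : V × ℤ, f.1 ∈ Ψ → |f.2| ≤ k → (∀ z ∈ R, 0 < eval z f) → 0 ≤ eval y f ∧
        (eval y f = 0 → f ∈ AddSubmonoid.closure (Set.range m)) := by
  obtain ⟨x, hxR, hx, hτ⟩ := exists_minimal_alcove hΨ hR hne hB
  have hind : ∀ i, IsIndecomposable Ψ x (m i) := fun i ↦
    hJ.isIndecomposable_of_isWallRoot hΨ hξ hx (hpos x hxR)
      (fun τ h1 h2 ↦ hmem τ h2 (hτ τ h1 h2).1 (hτ τ h1 h2).2) (hm i)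
  obtain ⟨hli, y, hy, hyf⟩ := AffineRoot.exists_face_point hΨ hx hind hinj
    fun i ↦ (hJ.subset (hm i).mem).2
  exact ⟨hli, y, hy, fun f h1 h2 h3 ↦ hyf f ⟨h1, hxR f h1 h2 h3⟩⟩

end AffineRoot

/-! ### Root subsystems, and dominant regions as cells. -/

namespace RootPairing

variable {ι V : Type*} [NormedAddCommGroup V] [InnerProductSpace ℝ V] {P : RootPairing ι ℝ V V}

lemma mem_affineHyperplane {i : ι} {r : ℕ} {x : V} :
    x ∈ P.affineHyperplane i r ↔ ⟪x, P.root i⟫ = r := Iff.rfl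

lemma IsEuclidean.pairing_mul (hP : P.IsEuclidean) (i j : ι) :
    2 * ⟪P.root i, P.root j⟫ = P.pairing i j * ⟪P.root j, P.root j⟫ := by
  have h0 : ⟪P.root j, P.root j⟫ ≠ 0 := inner_self_ne_zero.mpr (P.ne_zero j)
  have : P.pairing i j = ⟪P.root i, P.coroot j⟫ := by
    rw [← P.root_coroot_eq_pairing, hP.toLinearMap_eq, innerₗ_apply_apply]
  rw [this, hP.coroot_eq, inner_smul_right]
  field_simp

/-- The roots orthogonal to `l`. -/
def orthogonalRoots (P : RootPairing ι ℝ V V) (l : V) : Set V :=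
  {v | v ∈ Set.range P.root ∧ ⟪l, v⟫ = 0}

lemma IsEuclidean.isRootSet [Finite ι] [P.IsCrystallographic] [P.IsReduced] (hP : P.IsEuclidean)
    (l : V) : AffineRoot.IsRootSet (P.orthogonalRoots l) where
  finite := (Set.finite_range P.root).subset fun v hv ↦ hv.1
  ne_zero := by
    rintro v ⟨⟨i, rfl⟩, -⟩
    exact P.ne_zero i
  neg_mem := by
    rintro v ⟨hv, h⟩
    exact ⟨P.neg_mem_range_root_iff.mpr hv, by simpa using h⟩
  sub_mem := by
    rintro u ⟨⟨i, rfl⟩, hi⟩ v ⟨⟨j, rfl⟩, hj⟩ hpos hne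
    refine ⟨P.root_sub_root_mem_of_pairingIn_pos ?_ fun h ↦ hne (h ▸ rfl), ?_⟩
    · have h1 := hP.pairing_mul i j
      have h2 : 0 < ⟪P.root j, P.root j⟫ := real_inner_self_pos.mpr (P.ne_zero j)
      rw [← P.algebraMap_pairingIn ℤ] at h1
      have h3 : (0 : ℝ) < algebraMap ℤ ℝ (P.pairingIn ℤ i j) := by
        by_contra! h
        nlinarith
      simpa using h3
    · rw [inner_sub_right, hi, hj, sub_zero]
  exists_reflection := by
    rintro u ⟨⟨i, rfl⟩, hi⟩ v ⟨⟨j, rfl⟩, hj⟩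
    have h1 : ((P.pairingIn ℤ i j : ℤ) : ℝ) = P.pairing i j := by
      simpa using P.algebraMap_pairingIn ℤ i j
    refine ⟨P.pairingIn ℤ i j, ?_, ⟨P.reflectionPerm j i, ?_⟩, ?_⟩
    · rw [h1, hP.pairing_mul]
    · rw [h1, P.root_reflectionPerm, P.reflection_apply_root]
    · rw [inner_sub_right, inner_smul_right, hi, hj]; simp
  reduced := by
    rintro u ⟨⟨i, rfl⟩, -⟩ c ⟨⟨j, hj⟩, -⟩
    have := IsReduced.eq_or_eq_neg (P := P) i j (by
      rw [LinearIndependent.pair_iff]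
      push Not
      exact ⟨c, -1, by rw [hj]; simp, fun _ ↦ by norm_num⟩)
    have h0 := P.ne_zero i
    rcases this with h | h
    · left
      have h1 : (c - 1) • P.root i = 0 := by rw [sub_smul, one_smul, ← hj, ← h, sub_self]
      linarith [(smul_eq_zero.mp h1).resolve_right h0]
    · right
      have h1 : (c + 1) • P.root i = 0 := by rw [add_smul, one_smul, ← hj, h]; simp
      linarith [(smul_eq_zero.mp h1).resolve_right h0]

namespace Base

variable (b : P.Base)

lemma exists_inner_root_eq (c : ι → ℝ) :
    ∃ u : V, ∀ i ∈ b.support, ⟪u, P.root i⟫ = c i := by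
  obtain ⟨u, hu⟩ := AffineRoot.exists_inner_eq b.linearIndepOn_root (fun i ↦ c i)
  exact ⟨u, fun i hi ↦ hu ⟨i, hi⟩⟩

variable {b}

lemma IsPos.inner_nonneg [Finite ι] [P.IsCrystallographic] {u : V}
    (hu : ∀ i ∈ b.support, 0 ≤ ⟪u, P.root i⟫) {i : ι} (hi : b.IsPos i) : 0 ≤ ⟪u, P.root i⟫ := by
  refine hi.induction_on_add (p := fun i ↦ 0 ≤ ⟪u, P.root i⟫) hu fun i j k hk h1 hj ↦ ?_
  rw [hk, inner_add_right]
  exact add_nonneg h1 (hu j hj)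

lemma IsPos.inner_pos [Finite ι] [P.IsCrystallographic] {u : V}
    (hu : ∀ i ∈ b.support, 0 < ⟪u, P.root i⟫) {i : ι} (hi : b.IsPos i) : 0 < ⟪u, P.root i⟫ := by
  refine hi.induction_on_add (p := fun i ↦ 0 < ⟪u, P.root i⟫) hu fun i j k hk h1 hj ↦ ?_
  rw [hk, inner_add_right]
  exact add_pos h1 (hu j hj)

lemma exists_isPos_or_neg [Finite ι] (b : P.Base) (i : ι) :
    b.IsPos i ∨ ∃ j, b.IsPos j ∧ P.root i = -P.root j := by
  let _ := P.indexNeg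
  refine (IsPos.or_neg b i).imp_right fun h ↦ ⟨-i, h, by simp⟩

/-- The points `z` such that `j < ⟪z, α⟫` or `⟪z, α⟫ < j`, for `α` positive with index `i` and
`j ≤ k`, according to whether `S i j` holds. -/
def cell (b : P.Base) (k : ℕ) (S : ι → ℕ → Prop) : Set V :=
  {z | ∀ i, b.IsPos i → ∀ j ≤ k, (S i j → (j : ℝ) < ⟪z, P.root i⟫) ∧
    (¬ S i j → ⟪z, P.root i⟫ < j)}

lemma iff_of_mem_cell {k : ℕ} {S : ι → ℕ → Prop} {z : V} (hz : z ∈ b.cell k S) {i : ι}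
    (hi : b.IsPos i) {j : ℕ} (hj : j ≤ k) : S i j ↔ (j : ℝ) < ⟪z, P.root i⟫ := by
  refine ⟨(hz i hi j hj).1, fun h ↦ ?_⟩
  by_contra hS
  exact lt_asymm h ((hz i hi j hj).2 hS)

lemma cell_congr {k : ℕ} {S S' : ι → ℕ → Prop}
    (h : ∀ i, b.IsPos i → ∀ j ≤ k, (S i j ↔ S' i j)) : b.cell k S = b.cell k S' := by
  ext z
  refine forall_congr' fun i ↦ forall_congr' fun hi ↦ forall_congr' fun j ↦
    forall_congr' fun hj ↦ ?_
  rw [h i hi j hj]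

lemma cell_eq_cell_iff {k : ℕ} {S S' : ι → ℕ → Prop} (hne : (b.cell k S).Nonempty) :
    b.cell k S = b.cell k S' ↔ ∀ i, b.IsPos i → ∀ j ≤ k, (S i j ↔ S' i j) := by
  refine ⟨fun h i hi j hj ↦ ?_, cell_congr⟩
  obtain ⟨z, hz⟩ := hne
  exact (iff_of_mem_cell hz hi hj).trans (iff_of_mem_cell (h ▸ hz) hi hj).symm

lemma convex_cell (k : ℕ) (S : ι → ℕ → Prop) : Convex ℝ (b.cell k S) := by
  intro x hx y hy s t hs ht hst i hi j hj
  have h1 := hx i hi j hj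
  have h2 := hy i hi j hj
  rw [inner_add_left, inner_smul_left, inner_smul_left, conj_trivial, conj_trivial]
  refine ⟨fun h ↦ ?_, fun h ↦ ?_⟩
  · exact (convex_Ioi (j : ℝ)) (h1.1 h) (h2.1 h) hs ht hst
  · exact (convex_Iio (j : ℝ)) (h1.2 h) (h2.2 h) hs ht hst

lemma isOpen_cell [Finite ι] (k : ℕ) (S : ι → ℕ → Prop) : IsOpen (b.cell k S) := by
  have : b.cell k S = ⋂ i : ι, ⋂ j : Fin (k + 1), {z | b.IsPos i →
      (S i j → ((j : ℕ) : ℝ) < ⟪z, P.root i⟫) ∧ (¬ S i j → ⟪z, P.root i⟫ < (j : ℕ))} := by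
    ext z
    simp only [Set.mem_iInter]
    exact ⟨fun h i j hi ↦ h i hi j (by lia), fun h i hi j hj ↦ h i ⟨j, by lia⟩ hi⟩
  rw [this]
  refine isOpen_iInter_of_finite fun i ↦ isOpen_iInter_of_finite fun j ↦ ?_
  by_cases hi : b.IsPos i <;> by_cases hS : S i j <;> simp only [hi, hS, true_imp_iff,
    false_imp_iff, not_true_eq_false, not_false_eq_true, and_true, true_and, Set.ofPred_true,
    isOpen_univ]
  · exact isOpen_lt continuous_const (by fun_prop)
  · exact isOpen_lt (by fun_prop) continuous_const

lemma cell_subset_catalanComplement [Finite ι] {k : ℕ} {S : ι → ℕ → Prop}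
    (h0 : ∀ i, b.IsPos i → S i 0) : b.cell k S ⊆ P.catalanComplement k := by
  rintro z hz H ⟨i, j, hj, rfl⟩ hzH
  rw [mem_affineHyperplane] at hzH
  rcases b.exists_isPos_or_neg i with hi | ⟨i', hi', e⟩
  · have := hz i hi j hj
    by_cases hS : S i j
    · exact (this.1 hS).ne' hzH
    · exact (this.2 hS).ne hzH
  -- Hyperplanes of negative roots at height `j ≥ 0` miss the open dominant chamber.
  · have h1 := (hz i' hi' 0 (by lia)).1 (h0 i' hi')
    rw [e, inner_neg_right] at hzH
    have h2 : (0 : ℝ) ≤ j := by positivity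
    push_cast at h1
    linarith

/-- The cell is convex, hence connected; conversely, on a connected part of the complement no `⟪·,
α⟫` can cross a value `j ≤ k`. -/
lemma connectedComponentIn_eq_cell [Finite ι] {k : ℕ} {S : ι → ℕ → Prop}
    (h0 : ∀ i, b.IsPos i → S i 0) {x : V} (hx : x ∈ b.cell k S) :
    connectedComponentIn (P.catalanComplement k) x = b.cell k S := by
  refine Set.Subset.antisymm (fun z hz i hi j hj ↦ ?_)
    ((convex_cell k S).isPreconnected.subset_connectedComponentIn hx
      (cell_subset_catalanComplement h0))
  have hpre : IsPreconnected (connectedComponentIn (P.catalanComplement k) x) :=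
    isPreconnected_connectedComponentIn
  have hxm : x ∈ connectedComponentIn (P.catalanComplement k) x :=
    mem_connectedComponentIn (cell_subset_catalanComplement h0 hx)
  have hcont : ContinuousOn (fun y : V ↦ ⟪y, P.root i⟫)
      (connectedComponentIn (P.catalanComplement k) x) := by fun_prop
  have hnot : ∀ y ∈ connectedComponentIn (P.catalanComplement k) x, ⟪y, P.root i⟫ ≠ j :=
    fun y hy h ↦ connectedComponentIn_subset _ _ hy _ ⟨i, j, hj, rfl⟩ h
  refine ⟨fun h ↦ ?_, fun h ↦ ?_⟩
  · by_contra! hle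
    obtain ⟨y, hy, e⟩ := hpre.intermediate_value hz hxm hcont ⟨hle, ((hx i hi j hj).1 h).le⟩
    exact hnot y hy e
  · by_contra! hle
    obtain ⟨y, hy, e⟩ := hpre.intermediate_value hxm hz hcont ⟨((hx i hi j hj).2 h).le, hle⟩
    exact hnot y hy e

lemma isDominantCatalanRegion_cell [Finite ι] {k : ℕ} {S : ι → ℕ → Prop}
    (h0 : ∀ i, b.IsPos i → S i 0) (hne : (b.cell k S).Nonempty) :
    b.IsDominantCatalanRegion k (b.cell k S) := by
  obtain ⟨x, hx⟩ := hne
  refine ⟨⟨x, cell_subset_catalanComplement h0 hx, (connectedComponentIn_eq_cell h0 hx).symm⟩,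
    fun i hi z hz ↦ ?_⟩
  simpa using (hz i hi 0 (by lia)).1 (h0 i hi)

lemma IsDominantCatalanRegion.exists_eq_cell [Finite ι] {k : ℕ} {R : Set V}
    (hR : b.IsDominantCatalanRegion k R) :
    ∃ S : ι → ℕ → Prop, (∀ i, b.IsPos i → S i 0) ∧ R = b.cell k S ∧ R.Nonempty := by
  obtain ⟨⟨x, hx, rfl⟩, hdom⟩ := hR
  have hxm := mem_connectedComponentIn hx
  have h0 : ∀ i, b.IsPos i → ((0 : ℕ) : ℝ) < ⟪x, P.root i⟫ := fun i hi ↦ by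
    simpa using hdom i hi x hxm
  refine ⟨fun i j ↦ (j : ℝ) < ⟪x, P.root i⟫, h0, connectedComponentIn_eq_cell h0 ?_, x, hxm⟩
  refine fun i hi j hj ↦ ⟨id, fun h ↦ lt_of_le_of_ne (not_lt.mp h) fun e ↦ ?_⟩
  exact hx _ ⟨i, j, hj, rfl⟩ e

lemma finite_isDominantCatalanRegion [Finite ι] (k : ℕ) :
    {R | b.IsDominantCatalanRegion k R}.Finite := by
  have : {R | b.IsDominantCatalanRegion k R} ⊆
      Set.range fun A : Set (ι × Fin (k + 1)) ↦
        b.cell k fun i j ↦ ∃ h : j < k + 1, (i, ⟨j, h⟩) ∈ A := by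
    intro R hR
    obtain ⟨S, -, rfl, -⟩ := IsDominantCatalanRegion.exists_eq_cell hR
    refine ⟨{p | S p.1 p.2}, cell_congr fun i _ j hj ↦ ?_⟩
    simp only [Set.mem_ofPred_eq, exists_prop, and_iff_right_iff_imp]
    exact fun _ ↦ by lia
  exact (Set.finite_range _).subset this

end Base

end RootPairing

/-! ### Floors and ceilings, and the two opposite cells at a face point. -/

namespace RootPairing

variable {ι V : Type*} [NormedAddCommGroup V] [InnerProductSpace ℝ V] {P : RootPairing ι ℝ V V}

lemma sOppSide_affineHyperplane_iff {i : ι} {r : ℕ} (hr : 1 ≤ r) {x : V} :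
    (P.affineHyperplane i r).SOppSide 0 x ↔ (r : ℝ) < ⟪x, P.root i⟫ := by
  have hr' : (0 : ℝ) < r := by exact_mod_cast hr
  simp only [AffineSubspace.SOppSide, AffineSubspace.wOppSide_iff_exists_wbtw,
    mem_affineHyperplane, inner_zero_left]
  constructor
  · rintro ⟨⟨p, hp, t, ht, rfl⟩, -, hx⟩
    rw [AffineMap.lineMap_apply] at hp
    simp only [vsub_eq_sub, sub_zero, vadd_eq_add, add_zero, inner_smul_left, conj_trivial] at hp
    refine lt_of_le_of_ne ?_ (Ne.symm hx)
    have h1 : 0 < ⟪x, P.root i⟫ := by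
      by_contra! h
      nlinarith [ht.1]
    nlinarith [ht.2]
  · intro h
    have h1 : 0 < ⟪x, P.root i⟫ := hr'.trans h
    refine ⟨⟨((r : ℝ) / ⟪x, P.root i⟫) • x, ?_, (r : ℝ) / ⟪x, P.root i⟫, ⟨by positivity, ?_⟩, ?_⟩,
      hr'.ne, h.ne'⟩
    · rw [inner_smul_left, conj_trivial]
      field_simp
    · rw [div_le_one h1]; exact h.le
    · simp [AffineMap.lineMap_apply]

lemma sSameSide_affineHyperplane_iff {i : ι} {r : ℕ} (hr : 1 ≤ r) {x : V} :
    (P.affineHyperplane i r).SSameSide 0 x ↔ ⟪x, P.root i⟫ < r := by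
  have hr' : (0 : ℝ) < r := by exact_mod_cast hr
  constructor
  · rintro h
    refine lt_of_le_of_ne (not_lt.mp fun h1 ↦ ?_) h.2.2
    exact ((sOppSide_affineHyperplane_iff hr).mpr h1).not_sSameSide h
  · intro h
    refine ⟨?_, by simpa [mem_affineHyperplane] using hr'.ne, by
      simpa [mem_affineHyperplane] using h.ne⟩
    have h0 : 0 < ⟪P.root i, P.root i⟫ := real_inner_self_pos.mpr (P.ne_zero i)
    set p := ((r : ℝ) / ⟪P.root i, P.root i⟫) • P.root i with hp
    have hpr : ⟪p, P.root i⟫ = r := by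
      rw [hp, inner_smul_left, conj_trivial]; field_simp
    set c := ((r : ℝ) - ⟪x, P.root i⟫) / r with hc
    have hc0 : 0 ≤ c := div_nonneg (by linarith) hr'.le
    refine ⟨p, hpr, x + c • p, ?_, ?_⟩
    · rw [mem_affineHyperplane, inner_add_left, inner_smul_left, hpr, conj_trivial, hc]
      field_simp
      ring
    · have : x -ᵥ (x + c • p) = c • ((0 : V) -ᵥ p) := by simp
      rw [this]
      exact SameRay.sameRay_nonneg_smul_right _ hc0

variable {k r : ℕ} {R : Set V} {i : ι}

lemma zero_notMem_affineHyperplane (hr : 1 ≤ r) : (0 : V) ∉ P.affineHyperplane i r := by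
  rw [mem_affineHyperplane, inner_zero_left]
  exact_mod_cast (by lia : 0 ≠ r)

lemma isCatalanFloor_iff (hr : 1 ≤ r) (hrk : r ≤ k) :
    P.IsCatalanFloor k R (P.affineHyperplane i r) ↔
      affineSpan ℝ (closure R ∩ (P.affineHyperplane i r : Set V)) = P.affineHyperplane i r ∧
        ∀ x ∈ R, (r : ℝ) < ⟪x, P.root i⟫ := by
  simp only [IsCatalanFloor, IsCatalanWall, sOppSide_affineHyperplane_iff hr]
  exact ⟨fun h ↦ ⟨h.1.2, h.2.2⟩,
    fun h ↦ ⟨⟨⟨i, r, hrk, rfl⟩, h.1⟩, zero_notMem_affineHyperplane hr, h.2⟩⟩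

lemma isCatalanCeiling_iff (hr : 1 ≤ r) (hrk : r ≤ k) :
    P.IsCatalanCeiling k R (P.affineHyperplane i r) ↔
      affineSpan ℝ (closure R ∩ (P.affineHyperplane i r : Set V)) = P.affineHyperplane i r ∧
        ∀ x ∈ R, ⟪x, P.root i⟫ < r := by
  simp only [IsCatalanCeiling, IsCatalanWall, sSameSide_affineHyperplane_iff hr]
  exact ⟨fun h ↦ ⟨h.1.2, h.2.2⟩,
    fun h ↦ ⟨⟨⟨i, r, hrk, rfl⟩, h.1⟩, zero_notMem_affineHyperplane hr, h.2⟩⟩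

/-- Lets walls of height `r` be counted by roots. The bound `r ≥ 1` is essential: at height `0`
opposite roots share a hyperplane. -/
lemma affineHyperplane_injective (hr : 1 ≤ r) {i j : ι}
    (h : P.affineHyperplane i r = P.affineHyperplane j r) : i = j := by
  have hr' : (0 : ℝ) < r := by exact_mod_cast hr
  have h0 : 0 < ⟪P.root i, P.root i⟫ := real_inner_self_pos.mpr (P.ne_zero i)
  have key : ∀ w : V, ⟪w, P.root i⟫ = 0 →
      ⟪((r : ℝ) / ⟪P.root i, P.root i⟫) • P.root i + w, P.root j⟫ = r := by
    intro w hw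
    rw [← mem_affineHyperplane, ← h, mem_affineHyperplane, inner_add_left, inner_smul_left, hw,
      conj_trivial]
    field_simp
    ring
  have k0 := key 0 (by simp)
  rw [add_zero, inner_smul_left, conj_trivial] at k0
  have hij : ⟪P.root i, P.root j⟫ = ⟪P.root i, P.root i⟫ := by
    field_simp at k0
    exact k0
  have hw : ⟪P.root j - P.root i, P.root i⟫ = 0 := by
    rw [inner_sub_left, real_inner_comm, hij, sub_self]
  have k1 := key _ hw
  rw [inner_add_left, inner_smul_left, conj_trivial, k0] at k1
  have : ⟪P.root j - P.root i, P.root j - P.root i⟫ = 0 := by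
    rw [inner_sub_right, hw]; linarith
  exact P.root.injective (sub_eq_zero.mp (inner_self_eq_zero.mp this)).symm

/-- A set whose closure contains a point of a hyperplane and, close to it, points of the hyperplane
in all directions has that hyperplane as the span of a face. -/
lemma affineSpan_closure_inter_eq {C : Set V} {p : V} (hp : ⟪p, P.root i⟫ = r)
    (h : ∀ w : V, ⟪w, P.root i⟫ = 0 → ∃ t : ℝ, t ≠ 0 ∧ p + t • w ∈ closure C) :
    affineSpan ℝ (closure C ∩ (P.affineHyperplane i r : Set V)) = P.affineHyperplane i r := by
  refine le_antisymm (affineSpan_le.mpr Set.inter_subset_right) fun q hq ↦ ?_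
  have hpC : p ∈ closure C ∩ (P.affineHyperplane i r : Set V) := by
    obtain ⟨t, -, ht⟩ := h 0 (by simp)
    exact ⟨by simpa using ht, hp⟩
  rw [mem_affineHyperplane] at hq
  obtain ⟨t, ht0, ht⟩ := h (q - p) (by rw [inner_sub_left, hp, hq, sub_self])
  have hm : p + t • (q - p) ∈ closure C ∩ (P.affineHyperplane i r : Set V) := by
    refine ⟨ht, mem_affineHyperplane.mpr ?_⟩
    rw [inner_add_left, inner_smul_left, inner_sub_left, hp, hq]; simp
  have := AffineMap.lineMap_mem (t⁻¹ : ℝ) (mem_affineSpan ℝ hpC) (mem_affineSpan ℝ hm)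
  convert this using 1
  simp [AffineMap.lineMap_apply, smul_smul, inv_mul_cancel₀ ht0]

namespace Base

variable (b : P.Base)

/-- A dominant point lying on the hyperplanes of height `r` of the roots in `M`, whose other
hyperplanes of the arrangement are redundant in the cone these span. -/
structure IsFacePoint (k r : ℕ) (M : Set ι) (y : V) : Prop where
  isPos : ∀ i ∈ M, b.IsPos i
  linearIndepOn : LinearIndepOn ℝ P.root M
  inner_eq : ∀ i ∈ M, ⟪y, P.root i⟫ = r
  inner_pos : ∀ i, b.IsPos i → 0 < ⟪y, P.root i⟫
  mem_closure : ∀ i, b.IsPos i → ∀ j ≤ k, ⟪y, P.root i⟫ = (j : ℝ) →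
    ((P.root i, -(j : ℤ)) : V × ℤ) ∈ AddSubmonoid.closure ((fun i ↦ (P.root i, -(r : ℤ))) '' M)

/-- The cell just above the point `y`. -/
def upperCell (k : ℕ) (y : V) : Set V := b.cell k fun i j ↦ (j : ℝ) ≤ ⟪y, P.root i⟫

/-- The cell just below the point `y`. -/
def lowerCell (k : ℕ) (y : V) : Set V := b.cell k fun i j ↦ (j : ℝ) < ⟪y, P.root i⟫

variable {b} {M : Set ι} {y : V}

lemma exists_inner_pos [Finite ι] [P.IsCrystallographic] (b : P.Base) :
    ∃ u : V, ∀ i, b.IsPos i → 0 < ⟪u, P.root i⟫ := by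
  obtain ⟨u, hu⟩ := b.exists_inner_root_eq 1
  exact ⟨u, fun i hi ↦ hi.inner_pos fun j hj ↦ by rw [hu j hj]; simp⟩

namespace IsFacePoint

/-- Hyperplanes through `y` come from sums of the affine roots of `M`, so a direction positive on
`M` is positive on all of them. -/
lemma inner_pos_of_eq (hy : b.IsFacePoint k r M y) {w : V} (hw : ∀ i ∈ M, 0 < ⟪w, P.root i⟫)
    {i : ι} (hi : b.IsPos i) {j : ℕ} (hj : j ≤ k) (e : ⟪y, P.root i⟫ = (j : ℝ)) :
    0 < ⟪w, P.root i⟫ := by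
  have key : ∀ f ∈ AddSubmonoid.closure ((fun i ↦ ((P.root i, -(r : ℤ)) : V × ℤ)) '' M),
      f = 0 ∨ 0 < ⟪w, f.1⟫ := by
    intro f hf
    induction hf using AddSubmonoid.closure_induction with
    | mem f hf =>
      obtain ⟨i, hi, rfl⟩ := hf
      exact Or.inr (hw i hi)
    | zero => exact Or.inl rfl
    | add f g _ _ ihf ihg =>
      rcases ihf with rfl | h1
      · simpa using ihg
      rcases ihg with rfl | h2
      · simpa using Or.inr h1
      · right
        rw [Prod.fst_add, inner_add_right]; exact add_pos h1 h2
  refine (key _ (hy.mem_closure i hi j hj e)).resolve_left fun h ↦ P.ne_zero i ?_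
  exact congrArg Prod.fst h

-- Hyperplanes through `y` are settled by `inner_pos_of_eq`; the finitely many others are not
-- crossed by a small displacement.
open Filter Topology in
lemma eventually_mem_cell [Finite ι] (hy : b.IsFacePoint k r M y) :
    ∀ᶠ w in 𝓝 (0 : V), (∀ i ∈ M, 0 < ⟪w, P.root i⟫) →
      y + w ∈ b.upperCell k y ∧ y - w ∈ b.lowerCell k y := by
  have h : ∀ᶠ w in 𝓝 (0 : V), ∀ i : ι, ∀ j : Fin (k + 1),
      ((((j : ℕ) : ℝ) < ⟪y, P.root i⟫ →
        ((j : ℕ) : ℝ) < ⟪y + w, P.root i⟫ ∧ ((j : ℕ) : ℝ) < ⟪y - w, P.root i⟫)) ∧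
      ((⟪y, P.root i⟫ < ((j : ℕ) : ℝ) →
        ⟪y + w, P.root i⟫ < ((j : ℕ) : ℝ) ∧ ⟪y - w, P.root i⟫ < ((j : ℕ) : ℝ))) := by
    rw [eventually_all]
    intro i
    rw [eventually_all]
    intro j
    have h1 : Tendsto (fun w : V ↦ ⟪y + w, P.root i⟫) (𝓝 0) (𝓝 ⟪y, P.root i⟫) := by
      have : Continuous fun w : V ↦ ⟪y + w, P.root i⟫ := by fun_prop
      simpa using this.tendsto 0
    have h2 : Tendsto (fun w : V ↦ ⟪y - w, P.root i⟫) (𝓝 0) (𝓝 ⟪y, P.root i⟫) := by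
      have : Continuous fun w : V ↦ ⟪y - w, P.root i⟫ := by fun_prop
      simpa using this.tendsto 0
    refine Eventually.and ?_ ?_
    · rw [eventually_imp_distrib_left]
      exact fun h ↦ (h1.eventually_const_lt h).and (h2.eventually_const_lt h)
    · rw [eventually_imp_distrib_left]
      exact fun h ↦ (h1.eventually_lt_const h).and (h2.eventually_lt_const h)
  filter_upwards [h] with w h hw
  refine ⟨fun i hi j hj ↦ ?_, fun i hi j hj ↦ ?_⟩
  · have hij := h i ⟨j, by lia⟩
    refine ⟨fun hle ↦ ?_, fun hlt ↦ (hij.2 (not_le.mp hlt)).1⟩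
    rcases eq_or_lt_of_le hle with e | hlt
    · rw [inner_add_left, ← e]
      linarith [hy.inner_pos_of_eq hw hi hj e.symm]
    · exact (hij.1 hlt).1
  · have hij := h i ⟨j, by lia⟩
    refine ⟨fun hlt ↦ (hij.1 hlt).2, fun hle ↦ ?_⟩
    rcases eq_or_lt_of_le (not_lt.mp hle) with e | hlt
    · rw [inner_sub_left, e]
      linarith [hy.inner_pos_of_eq hw hi hj e]
    · exact (hij.2 hlt).2

-- Weak inequalities become strict after adding a small positive multiple of a strictly dominant
-- vector.
open Filter Topology in
lemma eventually_mem_closure_cell [Finite ι] [P.IsCrystallographic]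
    (hy : b.IsFacePoint k r M y) :
    ∀ᶠ w in 𝓝 (0 : V), (∀ i ∈ M, 0 ≤ ⟪w, P.root i⟫) →
      y + w ∈ closure (b.upperCell k y) ∧ y - w ∈ closure (b.lowerCell k y) := by
  obtain ⟨u, hu⟩ := exists_inner_pos b
  filter_upwards [hy.eventually_mem_cell.eventually_nhds] with w h hw
  have ht : Tendsto (fun t : ℝ ↦ w + t • u) (𝓝[>] 0) (𝓝 w) := by
    have : Continuous fun t : ℝ ↦ w + t • u := by fun_prop
    have := this.tendsto 0
    rw [zero_smul, add_zero] at this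
    exact this.mono_left nhdsWithin_le_nhds
  have hev : ∀ᶠ t : ℝ in 𝓝[>] 0, y + (w + t • u) ∈ b.upperCell k y ∧
      y - (w + t • u) ∈ b.lowerCell k y := by
    filter_upwards [ht.eventually h, self_mem_nhdsWithin] with t h ht0
    refine h fun i hi ↦ ?_
    rw [inner_add_left, inner_smul_left, conj_trivial]
    have h1 := hw i hi
    have h2 := mul_pos (Set.mem_Ioi.mp ht0) (hu i (hy.isPos i hi))
    linarith
  exact ⟨mem_closure_of_tendsto (ht.const_add y) (hev.mono fun t h ↦ h.1),
    mem_closure_of_tendsto (ht.const_sub y) (hev.mono fun t h ↦ h.2)⟩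

open Filter Topology in
lemma affineSpan_closure_cell [Finite ι] [P.IsCrystallographic] (hy : b.IsFacePoint k r M y)
    {i : ι} (hi : i ∈ M) :
    affineSpan ℝ (closure (b.upperCell k y) ∩ (P.affineHyperplane i r : Set V)) =
        P.affineHyperplane i r ∧
      affineSpan ℝ (closure (b.lowerCell k y) ∩ (P.affineHyperplane i r : Set V)) =
        P.affineHyperplane i r := by
  classical
  have := Fintype.ofFinite M
  -- Independence of `M` provides a direction along the hyperplane of `i` strictly inside the half
  -- spaces of the other roots of `M`; around it the face is open in that hyperplane.
  obtain ⟨w₀, hw₀⟩ := AffineRoot.exists_inner_eq hy.linearIndepOn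
    fun j : M ↦ if (j : ι) = i then 0 else 1
  have hw₀i : ⟪w₀, P.root i⟫ = 0 := by simpa using hw₀ ⟨i, hi⟩
  have hw₀j : ∀ j ∈ M, j ≠ i → 0 < ⟪w₀, P.root j⟫ := fun j hj hne ↦ by
    simp [show ⟪w₀, P.root j⟫ = _ from hw₀ ⟨j, hj⟩, hne]
  have hs : Tendsto (fun s : ℝ ↦ s • w₀) (𝓝[>] 0) (𝓝 0) := by
    have : Continuous fun s : ℝ ↦ s • w₀ := by fun_prop
    have := this.tendsto 0
    rw [zero_smul] at this
    exact this.mono_left nhdsWithin_le_nhds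
  obtain ⟨s, hs, hs0⟩ :=
    ((hs.eventually hy.eventually_mem_closure_cell.eventually_nhds).and self_mem_nhdsWithin).exists
  have hs0 : 0 < s := hs0
  have key : ∀ w : V, ⟪w, P.root i⟫ = 0 → ∃ t : ℝ, t ≠ 0 ∧
      y + (s • w₀ + t • w) ∈ closure (b.upperCell k y) ∧
      y - (s • w₀ + t • w) ∈ closure (b.lowerCell k y) := by
    intro w hw
    have ht : Tendsto (fun t : ℝ ↦ s • w₀ + t • w) (𝓝[≠] 0) (𝓝 (s • w₀)) := by
      have : Continuous fun t : ℝ ↦ s • w₀ + t • w := by fun_prop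
      have := this.tendsto 0
      rw [zero_smul, add_zero] at this
      exact this.mono_left nhdsWithin_le_nhds
    have hev : ∀ᶠ t : ℝ in 𝓝[≠] 0, ∀ j : M, 0 ≤ ⟪s • w₀ + t • w, P.root j⟫ := by
      rw [eventually_all]
      rintro ⟨j, hj⟩
      by_cases hji : j = i
      · refine Eventually.of_forall fun t ↦ ?_
        subst hji
        rw [inner_add_left, inner_smul_left, inner_smul_left, hw₀i, hw]; simp
      · have h1 : Tendsto (fun t : ℝ ↦ ⟪s • w₀ + t • w, P.root j⟫) (𝓝[≠] 0)
            (𝓝 ⟪s • w₀, P.root j⟫) := ht.inner tendsto_const_nhds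
        have h2 : 0 < ⟪s • w₀, P.root j⟫ := by
          rw [inner_smul_left, conj_trivial]; exact mul_pos hs0 (hw₀j j hj hji)
        exact (h1.eventually_const_lt h2).mono fun t ↦ le_of_lt
    obtain ⟨t, ⟨h1, h2⟩, h3⟩ := (((ht.eventually hs).and hev).and self_mem_nhdsWithin).exists
    exact ⟨t, h3, h1 fun j hj ↦ h2 ⟨j, hj⟩⟩
  constructor
  · refine affineSpan_closure_inter_eq (p := y + s • w₀) ?_ fun w hw ↦ ?_
    · rw [inner_add_left, inner_smul_left, hw₀i, hy.inner_eq i hi]; simp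
    · obtain ⟨t, ht, h, -⟩ := key w hw
      exact ⟨t, ht, by rwa [add_assoc]⟩
  · refine affineSpan_closure_inter_eq (p := y - s • w₀) ?_ fun w hw ↦ ?_
    · rw [inner_sub_left, inner_smul_left, hw₀i, hy.inner_eq i hi]; simp
    · obtain ⟨t, ht, -, h⟩ := key w hw
      refine ⟨-t, neg_ne_zero.mpr ht, ?_⟩
      convert h using 1
      rw [neg_smul]; abel

open Filter Topology in
lemma nonempty_cell [Finite ι] [P.IsCrystallographic] (hy : b.IsFacePoint k r M y) :
    (b.upperCell k y).Nonempty ∧ (b.lowerCell k y).Nonempty := by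
  have h := hy.eventually_mem_closure_cell.self_of_nhds (by simp)
  exact ⟨closure_nonempty_iff.mp ⟨_, h.1⟩, closure_nonempty_iff.mp ⟨_, h.2⟩⟩

lemma isDominantCatalanRegion_upperCell [Finite ι] [P.IsCrystallographic]
    (hy : b.IsFacePoint k r M y) : b.IsDominantCatalanRegion k (b.upperCell k y) :=
  isDominantCatalanRegion_cell (fun i hi ↦ by simpa using (hy.inner_pos i hi).le) hy.nonempty_cell.1

lemma isDominantCatalanRegion_lowerCell [Finite ι] [P.IsCrystallographic]
    (hy : b.IsFacePoint k r M y) : b.IsDominantCatalanRegion k (b.lowerCell k y) :=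
  isDominantCatalanRegion_cell (fun i hi ↦ by simpa using hy.inner_pos i hi) hy.nonempty_cell.2

lemma isCatalanFloor_upperCell [Finite ι] [P.IsCrystallographic] (hr : 1 ≤ r) (hrk : r ≤ k)
    (hy : b.IsFacePoint k r M y) {i : ι} (hi : i ∈ M) :
    P.IsCatalanFloor k (b.upperCell k y) (P.affineHyperplane i r) := by
  refine (isCatalanFloor_iff hr hrk).mpr ⟨(hy.affineSpan_closure_cell hi).1, fun x hx ↦ ?_⟩
  exact (hx i (hy.isPos i hi) r hrk).1 (hy.inner_eq i hi).ge

lemma isCatalanCeiling_lowerCell [Finite ι] [P.IsCrystallographic] (hr : 1 ≤ r) (hrk : r ≤ k)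
    (hy : b.IsFacePoint k r M y) {i : ι} (hi : i ∈ M) :
    P.IsCatalanCeiling k (b.lowerCell k y) (P.affineHyperplane i r) := by
  refine (isCatalanCeiling_iff hr hrk).mpr ⟨(hy.affineSpan_closure_cell hi).2, fun x hx ↦ ?_⟩
  exact (hx i (hy.isPos i hi) r hrk).2 (hy.inner_eq i hi).not_gt

lemma inner_eq_of_mem_closure (hy : b.IsFacePoint k r M y) {i : ι} {j : ℕ}
    (h : ((P.root i, -(j : ℤ)) : V × ℤ) ∈
      AddSubmonoid.closure ((fun i ↦ (P.root i, -(r : ℤ))) '' M)) :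
    ⟪y, P.root i⟫ = (j : ℝ) := by
  have : AddSubmonoid.closure ((fun i ↦ ((P.root i, -(r : ℤ)) : V × ℤ)) '' M) ≤
      (AddMonoidHom.ker (AffineRoot.eval y)).toAddSubmonoid := by
    rw [AddSubmonoid.closure_le]
    rintro _ ⟨i, hi, rfl⟩
    change AffineRoot.eval y _ = 0
    rw [AffineRoot.eval_apply, hy.inner_eq i hi]; simp
  have h1 : AffineRoot.eval y _ = 0 := this h
  rw [AffineRoot.eval_apply] at h1
  push_cast at h1
  linarith

/-- Two face points have the same cell above them if and only if they have the same cell below. -/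
lemma upperCell_eq_iff [Finite ι] [P.IsCrystallographic] (hy : b.IsFacePoint k r M y) {y' : V}
    (hy' : b.IsFacePoint k r M y') :
    b.upperCell k y = b.upperCell k y' ↔ b.lowerCell k y = b.lowerCell k y' := by
  rw [upperCell, upperCell, cell_eq_cell_iff hy.nonempty_cell.1, lowerCell, lowerCell,
    cell_eq_cell_iff hy.nonempty_cell.2]
  refine forall_congr' fun i ↦ forall_congr' fun hi ↦ forall_congr' fun j ↦
    forall_congr' fun hj ↦ ?_
  -- Passing through `y` amounts to membership in the monoid generated by `M`, which is the same for
  -- `y'`.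
  have h : ⟪y, P.root i⟫ = (j : ℝ) ↔ ⟪y', P.root i⟫ = (j : ℝ) :=
    ⟨fun e ↦ hy'.inner_eq_of_mem_closure (hy.mem_closure i hi j hj e),
      fun e ↦ hy.inner_eq_of_mem_closure (hy'.mem_closure i hi j hj e)⟩
  have h' : (j : ℝ) = ⟪y, P.root i⟫ ↔ (j : ℝ) = ⟪y', P.root i⟫ := by rw [eq_comm, h, eq_comm]
  rw [le_iff_lt_or_eq, le_iff_lt_or_eq]
  constructor
  · intro h1
    by_cases e : (j : ℝ) = ⟪y, P.root i⟫
    · rw [← e, ← h'.mp e]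
    · have e' := mt h'.mpr e
      simpa [e, e'] using h1
  · intro h1
    rw [h1, h']

end IsFacePoint

end Base

end RootPairing

/-! ### Face points of regions with prescribed floors. -/

namespace RootPairing

open AffineRoot

namespace Base

variable {ι V : Type*} [NormedAddCommGroup V] [InnerProductSpace ℝ V] {P : RootPairing ι ℝ V V}
  {b : P.Base} {k r : ℕ} {R : Set V} {M : Set ι}

lemma zeroSet_le_of_wall {i : ι} {m : V × ℤ}
    (hm : ∀ z, eval z m = 0 ↔ z ∈ P.affineHyperplane i r)
    (h : affineSpan ℝ (closure R ∩ (P.affineHyperplane i r : Set V)) = P.affineHyperplane i r) :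
    zeroSet m ≤ affineSpan ℝ (closure R ∩ {z | eval z m = 0}) := by
  intro z hz
  have e : {z | eval z m = 0} = (P.affineHyperplane i r : Set V) := Set.ext hm
  rw [e, h]
  exact (hm z).mp hz

lemma mem_orthogonalRoots_zero {v : V} : v ∈ P.orthogonalRoots 0 ↔ v ∈ Set.range P.root := by
  simp [orthogonalRoots]

variable [Finite ι]

lemma IsDominantCatalanRegion.forall_lt_or_forall_gt (hR : b.IsDominantCatalanRegion k R) {i : ι}
    (hi : b.IsPos i) {j : ℕ} (hj : j ≤ k) :
    (∀ z ∈ R, (j : ℝ) < ⟪z, P.root i⟫) ∨ ∀ z ∈ R, ⟪z, P.root i⟫ < j := by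
  obtain ⟨S, -, rfl, -⟩ := hR.exists_eq_cell
  by_cases hS : S i j
  · exact Or.inl fun z hz ↦ (hz i hi j hj).1 hS
  · exact Or.inr fun z hz ↦ (hz i hi j hj).2 hS

/-- An affine root of level at most `k` does not change sign on a dominant region. -/
lemma IsDominantCatalanRegion.eval_pos_or_neg (hR : b.IsDominantCatalanRegion k R) {f : V × ℤ}
    (hf : f.1 ∈ Set.range P.root) (hk : |f.2| ≤ k) :
    (∀ z ∈ R, 0 < eval z f) ∨ ∀ z ∈ R, eval z f < 0 := by
  have key : ∀ f : V × ℤ, (∃ i, b.IsPos i ∧ P.root i = f.1) → |f.2| ≤ k →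
      (∀ z ∈ R, 0 < eval z f) ∨ ∀ z ∈ R, eval z f < 0 := by
    rintro ⟨v, n⟩ ⟨i, hi, rfl : P.root i = v⟩ hk
    rcases le_or_gt n 0 with hn | hn
    · obtain ⟨j, rfl⟩ : ∃ j : ℕ, n = -j := ⟨n.natAbs, by lia⟩
      have hj : j ≤ k := by simpa using hk
      simp only [eval_apply, Int.cast_neg, Int.cast_natCast]
      refine (hR.forall_lt_or_forall_gt hi hj).imp (fun h z hz ↦ ?_) fun h z hz ↦ ?_ <;>
      · have := h z hz
        linarith
    · left
      intro z hz
      have h1 := hR.2 i hi z hz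
      have h2 : (0 : ℝ) < n := by exact_mod_cast hn
      rw [eval_apply]
      exact add_pos h1 h2
  obtain ⟨i, hi⟩ := hf
  rcases b.exists_isPos_or_neg i with h | ⟨j, hj, e⟩
  · exact key f ⟨i, h, hi⟩ hk
  · have := key (-f) ⟨j, hj, by rw [Prod.fst_neg, ← hi, e, neg_neg]⟩ (by simpa using hk)
    simp only [map_neg, Left.neg_pos_iff, Left.neg_neg_iff] at this
    exact this.symm

lemma IsDominantCatalanRegion.isOpen (hR : b.IsDominantCatalanRegion k R) : IsOpen R := by
  obtain ⟨S, -, rfl, -⟩ := hR.exists_eq_cell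
  exact isOpen_cell k S

lemma IsDominantCatalanRegion.nonempty (hR : b.IsDominantCatalanRegion k R) : R.Nonempty := by
  obtain ⟨S, -, -, h⟩ := hR.exists_eq_cell
  exact h

lemma IsDominantCatalanRegion.eq_cell (hR : b.IsDominantCatalanRegion k R) {S : ι → ℕ → Prop}
    (h : ∀ i, b.IsPos i → ∀ j ≤ k, (∀ z ∈ R, (j : ℝ) < ⟪z, P.root i⟫) → S i j)
    (h' : ∀ i, b.IsPos i → ∀ j ≤ k, (∀ z ∈ R, ⟪z, P.root i⟫ < j) → ¬ S i j) : R = b.cell k S := by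
  have hlt := fun {i} hi {j} hj ↦ hR.forall_lt_or_forall_gt (i := i) hi (j := j) hj
  obtain ⟨S', -, rfl, z, hz⟩ := hR.exists_eq_cell
  refine cell_congr fun i hi j hj ↦ ?_
  rw [iff_of_mem_cell hz hi hj]
  rcases hlt hi hj with h1 | h1
  · exact ⟨fun _ ↦ h i hi j hj h1, fun _ ↦ h1 z hz⟩
  · exact ⟨fun h2 ↦ absurd h2 (h1 z hz).not_gt, fun h2 ↦ absurd h2 (h' i hi j hj h1)⟩

lemma inner_ne_zero_of_pos {u : V} (hu : ∀ i, b.IsPos i → 0 < ⟪u, P.root i⟫) {v : V}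
    (hv : v ∈ Set.range P.root) : ⟪u, v⟫ ≠ 0 := by
  obtain ⟨i, rfl⟩ := hv
  rcases b.exists_isPos_or_neg i with h | ⟨j, hj, e⟩
  · exact (hu i h).ne'
  · rw [e, inner_neg_right]
    exact neg_ne_zero.mpr (hu j hj).ne'

lemma exists_isPos_of_inner_pos {u : V} (hu : ∀ i, b.IsPos i → 0 < ⟪u, P.root i⟫) {v : V}
    (hv : v ∈ Set.range P.root) (h : 0 < ⟪u, v⟫) : ∃ i, b.IsPos i ∧ P.root i = v := by
  obtain ⟨i, rfl⟩ := hv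
  rcases b.exists_isPos_or_neg i with hi | ⟨j, hj, e⟩
  · exact ⟨i, hi, rfl⟩
  · rw [e, inner_neg_right] at h
    linarith [hu j hj]

section Floor

/-- The affine roots with positive linear part and level at most `k` that are positive on `R`. -/
def floorRoots (P : RootPairing ι ℝ V V) (u : V) (k : ℕ) (R : Set V) : Set (V × ℤ) :=
  {f | f ∈ halfSpace (P.orthogonalRoots 0) u ∧ -f.2 ≤ k ∧ ∀ z ∈ R, 0 < eval z f}

lemma mem_floorRoots_of_nonneg {u : V} (hu : ∀ i, b.IsPos i → 0 < ⟪u, P.root i⟫)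
    (hR : b.IsDominantCatalanRegion k R) {f : V × ℤ} (hf : f ∈ halfSpace (P.orthogonalRoots 0) u)
    (h : 0 ≤ f.2) : f ∈ floorRoots P u k R := by
  refine ⟨hf, by lia, fun z hz ↦ ?_⟩
  obtain ⟨i, hi, e⟩ := exists_isPos_of_inner_pos hu hf.1.1 hf.2
  have h1 := hR.2 i hi z hz
  have h2 : (0 : ℝ) ≤ f.2 := by exact_mod_cast h
  rw [eval_apply, ← e]
  linarith

lemma eval_neg_of_notMem_floorRoots {u : V} (hu : ∀ i, b.IsPos i → 0 < ⟪u, P.root i⟫)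
    (hR : b.IsDominantCatalanRegion k R) {f : V × ℤ} (hf : f ∈ halfSpace (P.orthogonalRoots 0) u)
    (hk : -f.2 ≤ k) (h : f ∉ floorRoots P u k R) : ∀ z ∈ R, eval z f < 0 := by
  have h1 : f.2 < 0 := by
    by_contra! hc
    exact h (mem_floorRoots_of_nonneg hu hR hf hc)
  exact (hR.eval_pos_or_neg hf.1.1 (by rw [abs_of_neg h1]; exact hk)).resolve_left
    fun h2 ↦ h ⟨hf, hk, h2⟩

/-- Affine roots with nonnegative constant term belong to the set by dominance. If neither summand
belongs, both constant terms are negative, so both respect the bound `k` of the sum; then both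
summands are negative on `R`, but their sum is positive. -/
lemma isCofilter_floorRoots {u : V} (hu : ∀ i, b.IsPos i → 0 < ⟪u, P.root i⟫)
    (hR : b.IsDominantCatalanRegion k R) :
    IsCofilter (P.orthogonalRoots 0) u R (floorRoots P u k R) where
  subset f hf := hf.1
  add_one_mem f hf := by
    refine ⟨by simpa [halfSpace] using hf.1, ?_, fun z hz ↦ ?_⟩
    · have := hf.2.1
      rw [Prod.snd_add]; lia
    · rw [map_add, eval_const]
      have := hf.2.2 z hz
      push_cast; linarith
  eval_pos f hf := hf.2.2
  mem_or_mem f hf g hg h := by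
    by_contra! hc
    have h1 : f.2 < 0 := not_le.mp fun h' ↦ hc.1 (mem_floorRoots_of_nonneg hu hR hf h')
    have h2 : g.2 < 0 := not_le.mp fun h' ↦ hc.2 (mem_floorRoots_of_nonneg hu hR hg h')
    have h3 := h.2.1
    rw [Prod.snd_add] at h3
    obtain ⟨z, hz⟩ := hR.nonempty
    have h4 := eval_neg_of_notMem_floorRoots hu hR hf (by lia) hc.1 z hz
    have h5 := eval_neg_of_notMem_floorRoots hu hR hg (by lia) hc.2 z hz
    have h6 := h.2.2 z hz
    rw [map_add] at h6
    linarith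

/-- Minimality is `exists_eval_le_of_wall`. If `m + η` belongs, the constant term of `η` respects
the bound `k`, so `η` outside the set would be negative on `R`, although `m ≤ m + η` at some point
of `R`. -/
lemma isWallRoot_floorRoots [P.IsCrystallographic] [P.IsReduced] (hP : P.IsEuclidean) {u : V}
    (hu : ∀ i, b.IsPos i → 0 < ⟪u, P.root i⟫) (hR : b.IsDominantCatalanRegion k R)
    (hr : 1 ≤ r) (hrk : r ≤ k) {i : ι} (hi : b.IsPos i)
    (hfl : P.IsCatalanFloor k R (P.affineHyperplane i r)) :
    IsWallRoot (P.orthogonalRoots 0) u R (floorRoots P u k R) (P.root i, -(r : ℤ)) := by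
  obtain ⟨hspan, hlt⟩ := (isCatalanFloor_iff hr hrk).mp hfl
  have hm : ((P.root i, -(r : ℤ)) : V × ℤ) ∈ halfSpace (P.orthogonalRoots 0) u :=
    ⟨mem_orthogonalRoots_zero.mpr ⟨i, rfl⟩, hu i hi⟩
  have hex : ∀ δ ∈ floorRoots P u k R,
      ∃ z ∈ R, eval z ((P.root i, -(r : ℤ)) : V × ℤ) ≤ eval z δ := by
    intro δ hδ
    refine exists_eval_le_of_wall (hP.isRootSet 0) hm hδ.1 hR.nonempty
      (zeroSet_le_of_wall (fun z ↦ ?_) hspan) hδ.2.2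
    rw [eval_apply, mem_affineHyperplane]
    push_cast
    exact add_neg_eq_zero
  refine ⟨⟨hm, by simpa using hrk, fun z hz ↦ ?_⟩, hex, fun η hη h ↦ ?_⟩
  · rw [eval_apply]
    have := hlt z hz
    push_cast
    linarith
  · by_contra hc
    have h1 := h.2.1
    rw [Prod.snd_add] at h1
    obtain ⟨z, hz, hle⟩ := hex _ h
    have h2 := eval_neg_of_notMem_floorRoots hu hR hη (by lia) hc z hz
    rw [map_add] at hle
    linarith

/-- A dominant region with floors `M` of height `r` lies just above a face point. -/
lemma exists_isFacePoint_of_floor [FiniteDimensional ℝ V] [P.IsCrystallographic] [P.IsReduced]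
    (hP : P.IsEuclidean) (hR : b.IsDominantCatalanRegion k R) (hr : 1 ≤ r) (hrk : r ≤ k)
    (hM : ∀ i ∈ M, b.IsPos i)
    (hfl : ∀ i ∈ M, P.IsCatalanFloor k R (P.affineHyperplane i r)) :
    ∃ y, b.IsFacePoint k r M y ∧ R = b.upperCell k y := by
  obtain ⟨u, hu⟩ := exists_inner_pos b
  have := Fintype.ofFinite M
  -- All roots are orthogonal to `0`, so the truncation lies in the dominant chamber and is bounded
  -- below by `B = 0`.
  obtain ⟨hli, y, hyM, hy⟩ := (isCofilter_floorRoots hu hR).exists_face_point (k := k) (B := 0)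
    (m := fun i : M ↦ (P.root i, -(r : ℤ)))
    (hP.isRootSet 0) (fun v hv ↦ inner_ne_zero_of_pos hu hv.1) hR.isOpen hR.nonempty
    (fun x hx v hv hpos ↦ by
      have := hx (v, 0) hv (by simp)
        (mem_floorRoots_of_nonneg hu hR (f := (v, 0)) ⟨hv, hpos⟩ le_rfl).2.2
      simpa [eval_apply] using this.le)
    (fun f hf hk hpos ↦ ⟨hf, (neg_le_abs _).trans hk, hpos⟩)
    (fun x hx f hf ↦ by
      rcases le_or_gt f.2 0 with h | h
      · exact hx f hf.1.1 (by rw [abs_of_nonpos h]; exact hf.2.1) hf.2.2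
      · have h1 := hx (f.1, 0) hf.1.1 (by simp)
          (mem_floorRoots_of_nonneg hu hR (f := (f.1, 0)) hf.1 le_rfl).2.2
        have h2 : (0 : ℝ) < f.2 := by exact_mod_cast h
        rw [eval_apply] at h1 ⊢
        simp only [Int.cast_zero, add_zero] at h1
        exact add_pos h1 h2)
    (fun i ↦ isWallRoot_floorRoots hP hu hR hr hrk (hM i i.2) (hfl i i.2))
    (fun i j h ↦ Subtype.ext (P.root.injective (congrArg Prod.fst h)))
  rw [← Set.image_eq_range (fun i ↦ ((P.root i, -(r : ℤ)) : V × ℤ)) M] at hy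
  -- Neither `(-α, j)` nor `(α, 0)`, for `α` positive, has this form, so `y` lies strictly below the
  -- hyperplanes above `R` and strictly inside the dominant chamber.
  have hcl : ∀ f ∈ AddSubmonoid.closure ((fun i ↦ ((P.root i, -(r : ℤ)) : V × ℤ)) '' M),
      f = 0 ∨ 0 < ⟪u, f.1⟫ ∧ f.2 < 0 := by
    intro f hf
    induction hf using AddSubmonoid.closure_induction with
    | mem f hf =>
      obtain ⟨i, hi, rfl⟩ := hf
      exact Or.inr ⟨hu i (hM i hi), by simpa using (show 0 < r from hr)⟩
    | zero => exact Or.inl rfl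
    | add f g _ _ ihf ihg =>
      rcases ihf with rfl | h1
      · simpa using ihg
      rcases ihg with rfl | h2
      · simpa using Or.inr h1
      · right
        rw [Prod.fst_add, inner_add_right, Prod.snd_add]
        exact ⟨add_pos h1.1 h2.1, add_neg h1.2 h2.2⟩
  have hge : ∀ i, b.IsPos i → ∀ j ≤ k, (∀ z ∈ R, (j : ℝ) < ⟪z, P.root i⟫) →
      (j : ℝ) ≤ ⟪y, P.root i⟫ ∧ (⟪y, P.root i⟫ = (j : ℝ) → ((P.root i, -(j : ℤ)) : V × ℤ) ∈
        AddSubmonoid.closure ((fun i ↦ (P.root i, -(r : ℤ))) '' M)) := by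
    intro i hi j hj h
    have := hy (P.root i, -(j : ℤ)) (mem_orthogonalRoots_zero.mpr ⟨i, rfl⟩) (by simpa using hj)
      fun z hz ↦ by rw [eval_apply]; push_cast; linarith [h z hz]
    rw [eval_apply] at this
    push_cast at this
    exact ⟨by linarith [this.1], fun e ↦ this.2 (by linarith)⟩
  have hlt : ∀ i, b.IsPos i → ∀ j ≤ k, (∀ z ∈ R, ⟪z, P.root i⟫ < j) → ⟪y, P.root i⟫ < j := by
    intro i hi j hj h
    have := hy (-P.root i, (j : ℤ)) (mem_orthogonalRoots_zero.mpr
      (P.neg_mem_range_root_iff.mpr ⟨i, rfl⟩)) (by simpa using hj)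
      fun z hz ↦ by rw [eval_apply, inner_neg_right]; push_cast; linarith [h z hz]
    rw [eval_apply, inner_neg_right] at this
    push_cast at this
    refine lt_of_le_of_ne (by linarith [this.1]) fun e ↦ ?_
    rcases hcl _ (this.2 (by linarith)) with h1 | h1
    · exact P.ne_zero i (neg_eq_zero.mp (congrArg Prod.fst h1))
    · have h2 := h1.1
      rw [inner_neg_right] at h2
      linarith [hu i hi]
  refine ⟨y, ⟨hM, hli, fun i hi ↦ ?_, fun i hi ↦ ?_, fun i hi j hj e ↦ ?_⟩,
    hR.eq_cell (fun i hi j hj h ↦ (hge i hi j hj h).1) fun i hi j hj h ↦ (hlt i hi j hj h).not_ge⟩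
  · have := hyM ⟨i, hi⟩
    rw [eval_apply] at this
    push_cast at this
    linarith
  · have := hge i hi 0 (by lia) fun z hz ↦ by simpa using hR.2 i hi z hz
    refine lt_of_le_of_ne (by simpa using this.1) fun e ↦ ?_
    rcases hcl _ (this.2 (by simpa using e.symm)) with h1 | h1
    · exact P.ne_zero i (congrArg Prod.fst h1)
    · simpa using h1.2
  · rcases hR.forall_lt_or_forall_gt hi hj with h | h
    · exact (hge i hi j hj h).2 e
    · exact absurd e (hlt i hi j hj h).ne

end Floor

end Base

end RootPairing

/-! ### Face points of regions with prescribed ceilings. -/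

namespace RootPairing

open AffineRoot

namespace Base

variable {ι V : Type*} [NormedAddCommGroup V] [InnerProductSpace ℝ V] {P : RootPairing ι ℝ V V}
  {b : P.Base} {k r : ℕ} {R : Set V} {M : Set ι}

/-- The affine roots with negative linear part orthogonal to `l` that are bounded below by an affine
root positive on `R` and of level at most `k`. -/
def ceilingRoots (P : RootPairing ι ℝ V V) (u l : V) (k : ℕ) (R : Set V) : Set (V × ℤ) :=
  {f | f ∈ halfSpace (P.orthogonalRoots l) (-u) ∧
    ∃ n : ℤ, n ≤ f.2 ∧ n ≤ k ∧ ∀ z ∈ R, 0 < eval z (f.1, n)}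

variable [Finite ι] {u l : V}

lemma inner_neg_of_mem_halfSpace (hu : ∀ i, b.IsPos i → 0 < ⟪u, P.root i⟫)
    (hR : b.IsDominantCatalanRegion k R) {f : V × ℤ}
    (hf : f ∈ halfSpace (P.orthogonalRoots l) (-u)) {z : V} (hz : z ∈ R) : ⟪z, f.1⟫ < 0 := by
  obtain ⟨i, hi, e⟩ := exists_isPos_of_inner_pos hu (P.neg_mem_range_root_iff.mpr hf.1.1)
    (by simpa using hf.2)
  have := hR.2 i hi z hz
  rw [e, inner_neg_right] at this
  linarith

lemma eval_neg_of_notMem_ceilingRoots (hu : ∀ i, b.IsPos i → 0 < ⟪u, P.root i⟫)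
    (hR : b.IsDominantCatalanRegion k R) {f : V × ℤ}
    (hf : f ∈ halfSpace (P.orthogonalRoots l) (-u)) (hk : f.2 ≤ k)
    (h : f ∉ ceilingRoots P u l k R) : ∀ z ∈ R, eval z f < 0 := by
  rcases le_or_gt f.2 0 with h0 | h0
  · intro z hz
    have h1 := inner_neg_of_mem_halfSpace hu hR hf hz
    have h2 : (f.2 : ℝ) ≤ 0 := by exact_mod_cast h0
    rw [eval_apply]
    linarith
  · exact (hR.eval_pos_or_neg hf.1.1 (by rw [abs_of_pos h0]; exact hk)).resolve_left
      fun h2 ↦ h ⟨hf, f.2, le_rfl, hk, h2⟩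

/-- A summand, of level at least that of a positive affine root below the sum, is a ceiling root. -/
lemma mem_ceilingRoots_of_le (hu : ∀ i, b.IsPos i → 0 < ⟪u, P.root i⟫)
    (hR : b.IsDominantCatalanRegion k R) {f g : V × ℤ}
    (hf : f ∈ halfSpace (P.orthogonalRoots l) (-u))
    (hg : g ∈ halfSpace (P.orthogonalRoots l) (-u)) {n : ℤ} (hn : n ≤ k)
    (hpos : ∀ z ∈ R, 0 < eval z ((f + g).1, n)) (h : n ≤ f.2) : f ∈ ceilingRoots P u l k R := by
  refine ⟨hf, n, h, hn, fun z hz ↦ ?_⟩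
  have h1 := hpos z hz
  have h2 := inner_neg_of_mem_halfSpace hu hR hg hz
  rw [eval_apply] at h1 ⊢
  rw [Prod.fst_add, inner_add_right] at h1
  simp only at h1 ⊢
  linarith

/-- The witness `n ≤ k` allows constant terms beyond `k`, for stability under adding `1`. If a
summand has constant term at least `n`, it belongs, because the other linear part is negative on
`R`. Otherwise both constant terms are below `n ≤ k`, so two summands outside the set are negative
on `R`, contradicting positivity of the sum. -/
lemma isCofilter_ceilingRoots (hu : ∀ i, b.IsPos i → 0 < ⟪u, P.root i⟫)
    (hR : b.IsDominantCatalanRegion k R) :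
    IsCofilter (P.orthogonalRoots l) (-u) R (ceilingRoots P u l k R) where
  subset f hf := hf.1
  add_one_mem f hf := by
    obtain ⟨hf, n, h1, h2, h3⟩ := hf
    refine ⟨⟨by simpa using hf.1, by simpa using hf.2⟩, n, ?_, h2,
      fun z hz ↦ by simpa using h3 z hz⟩
    rw [Prod.snd_add]; lia
  eval_pos := by
    rintro f ⟨-, n, h1, -, h3⟩ z hz
    have := h3 z hz
    have h1' : (n : ℝ) ≤ f.2 := by exact_mod_cast h1
    rw [eval_apply] at this ⊢
    simp only at this
    linarith
  mem_or_mem f hf g hg h := by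
    obtain ⟨-, n, h1, h2, h3⟩ := h
    by_contra! hc
    have hfn : f.2 < n := not_le.mp fun h' ↦
      hc.1 (mem_ceilingRoots_of_le hu hR hf hg h2 h3 h')
    have hgn : g.2 < n := not_le.mp fun h' ↦
      hc.2 (mem_ceilingRoots_of_le hu hR hg hf h2 (by rwa [add_comm g f]) h')
    obtain ⟨z, hz⟩ := hR.nonempty
    have h4 := eval_neg_of_notMem_ceilingRoots hu hR hf (by lia) hc.1 z hz
    have h5 := eval_neg_of_notMem_ceilingRoots hu hR hg (by lia) hc.2 z hz
    have h6 := h3 z hz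
    have h7 : (n : ℝ) ≤ f.2 + g.2 := by exact_mod_cast h1
    rw [eval_apply] at h4 h5 h6
    rw [Prod.fst_add, inner_add_right] at h6
    simp only at h6
    linarith

/-- If `m + η` belongs with witness `n`, then `η` belongs when its constant term is at least `n`;
otherwise that term is below `k`, and `η` outside the set would be negative on `R`, against `m ≤ m +
η` at some point. -/
lemma isWallRoot_ceilingRoots [P.IsCrystallographic] [P.IsReduced] (hP : P.IsEuclidean)
    (hu : ∀ i, b.IsPos i → 0 < ⟪u, P.root i⟫) (hR : b.IsDominantCatalanRegion k R)
    (hr : 1 ≤ r) (hrk : r ≤ k) {i : ι} (hi : b.IsPos i) (hl : ⟪l, P.root i⟫ = 0)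
    (hcl : P.IsCatalanCeiling k R (P.affineHyperplane i r)) :
    IsWallRoot (P.orthogonalRoots l) (-u) R (ceilingRoots P u l k R) (-P.root i, (r : ℤ)) := by
  obtain ⟨hspan, hlt⟩ := (isCatalanCeiling_iff hr hrk).mp hcl
  have hm : ((-P.root i, (r : ℤ)) : V × ℤ) ∈ halfSpace (P.orthogonalRoots l) (-u) :=
    ⟨⟨P.neg_mem_range_root_iff.mpr ⟨i, rfl⟩, by simpa using hl⟩, by simpa using hu i hi⟩
  have hex : ∀ δ ∈ ceilingRoots P u l k R,
      ∃ z ∈ R, eval z ((-P.root i, (r : ℤ)) : V × ℤ) ≤ eval z δ := by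
    rintro δ ⟨hδ, n, h1, -, h3⟩
    obtain ⟨z, hz, hle⟩ := exists_eval_le_of_wall (f := (δ.1, n)) (hP.isRootSet l) hm hδ hR.nonempty
      (zeroSet_le_of_wall (fun z ↦ by
        rw [eval_apply, mem_affineHyperplane, inner_neg_right]
        push_cast
        exact neg_add_eq_zero) hspan) h3
    refine ⟨z, hz, hle.trans ?_⟩
    have h1' : (n : ℝ) ≤ δ.2 := by exact_mod_cast h1
    rw [eval_apply, eval_apply]
    simpa using h1'
  refine ⟨⟨hm, r, le_rfl, by exact_mod_cast hrk, fun z hz ↦ ?_⟩, hex, fun η hη h ↦ ?_⟩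
  · rw [eval_apply, inner_neg_right]
    have := hlt z hz
    push_cast
    linarith
  · by_contra hc
    obtain ⟨z, hz, hle⟩ := hex _ h
    obtain ⟨-, n, h1, h2, h3⟩ := h
    have hηn : η.2 < n := not_le.mp fun h' ↦
      hc (mem_ceilingRoots_of_le hu hR hη hm h2 (by rwa [add_comm η]) h')
    have h2 := eval_neg_of_notMem_ceilingRoots hu hR hη (by lia) hc z hz
    rw [map_add] at hle
    linarith

/-- A vector orthogonal to the simple roots smaller than `k` on `R` and positive on the others. -/
lemma exists_recession_vector [P.IsCrystallographic] (hR : b.IsDominantCatalanRegion k R) :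
    ∃ l : V, (∀ i ∈ b.support, ⟪l, P.root i⟫ = 0 → ∀ z ∈ R, ⟪z, P.root i⟫ < k) ∧
      (∀ i, b.IsPos i → 0 ≤ ⟪l, P.root i⟫) ∧
      ∀ i, b.IsPos i → 0 < ⟪l, P.root i⟫ → ∀ z ∈ R, (k : ℝ) < ⟪z, P.root i⟫ := by
  classical
  -- `l` pairs to `1` exactly with the simple roots exceeding `k` on `R`. A positive root not
  -- orthogonal to `l` involves such a simple root, hence exceeds `k` as well.
  obtain ⟨l, hl⟩ := b.exists_inner_root_eq
    fun i ↦ if ∀ z ∈ R, ⟪z, P.root i⟫ < k then 0 else 1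
  have h0 : ∀ i ∈ b.support, 0 ≤ ⟪l, P.root i⟫ := by
    intro i hi
    rw [hl i hi]
    split_ifs <;> simp
  have h1 : ∀ i ∈ b.support, 0 < ⟪l, P.root i⟫ → ∀ z ∈ R, (k : ℝ) < ⟪z, P.root i⟫ := by
    intro i hi h
    refine (hR.forall_lt_or_forall_gt (isPos_of_mem_support hi) le_rfl).resolve_right fun h' ↦ ?_
    rw [hl i hi, if_pos h'] at h
    exact lt_irrefl _ h
  refine ⟨l, fun i hi h ↦ ?_, fun i hi ↦ hi.inner_nonneg h0, fun i hi ↦ ?_⟩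
  · by_contra h'
    rw [hl i hi, if_neg h'] at h
    exact one_ne_zero h
  · refine (hi.induction_on_add (p := fun i ↦ (∀ z ∈ R, 0 < ⟪z, P.root i⟫) ∧
      (0 < ⟪l, P.root i⟫ → ∀ z ∈ R, (k : ℝ) < ⟪z, P.root i⟫))
      (fun i hi ↦ ⟨hR.2 i (isPos_of_mem_support hi), h1 i hi⟩) fun i j m hm ih hj ↦ ?_).2
    have hj' := hR.2 j (isPos_of_mem_support hj)
    rw [hm]
    simp only [inner_add_right]
    refine ⟨fun z hz ↦ add_pos (ih.1 z hz) (hj' z hz), fun h z hz ↦ ?_⟩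
    have a := ih.1 z hz
    have c := hj' z hz
    rcases lt_or_ge 0 ⟪l, P.root i⟫ with h2 | h2
    · linarith [ih.2 h2 z hz]
    · linarith [h1 j hj (by linarith) z hz]

/-- Provides the bound `B` when the half space is that of `-u`: `⟪u, α⟫` is the number of simple
summands of `α`, and when `α` is orthogonal to `l` each of them is at most `k` on the truncation. -/
lemma inner_le_of_mem_truncation [P.IsCrystallographic]
    (hu : ∀ i ∈ b.support, ⟪u, P.root i⟫ = 1)
    (hl : ∀ i ∈ b.support, ⟪l, P.root i⟫ = 0 → ∀ z ∈ R, ⟪z, P.root i⟫ < k)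
    (hl0 : ∀ i, b.IsPos i → 0 ≤ ⟪l, P.root i⟫) {x : V}
    (hx : x ∈ truncation (P.orthogonalRoots l) k R) {i : ι} (hi : b.IsPos i)
    (hli : ⟪l, P.root i⟫ = 0) : ⟪x, P.root i⟫ ≤ k * ⟪u, P.root i⟫ := by
  have h1 : ∀ i ∈ b.support, ⟪l, P.root i⟫ = 0 → ⟪x, P.root i⟫ ≤ k * ⟪u, P.root i⟫ := by
    intro i hi h
    have := hx (-P.root i, (k : ℤ))
      ⟨P.neg_mem_range_root_iff.mpr ⟨i, rfl⟩, by simpa using h⟩ (by simp) fun z hz ↦ by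
        rw [eval_apply, inner_neg_right]
        have := hl i hi h z hz
        push_cast
        linarith
    rw [eval_apply, inner_neg_right] at this
    push_cast at this
    rw [hu i hi]
    linarith
  refine (hi.induction_on_add (p := fun i ↦ 0 ≤ ⟪l, P.root i⟫ ∧ (⟪l, P.root i⟫ = 0 →
    ⟪x, P.root i⟫ ≤ k * ⟪u, P.root i⟫))
    (fun i hi ↦ ⟨hl0 i (isPos_of_mem_support hi), h1 i hi⟩) fun i j m hm ih hj ↦ ?_).2 hli
  have hj0 := hl0 j (isPos_of_mem_support hj)
  rw [hm]
  simp only [inner_add_right]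
  refine ⟨add_nonneg ih.1 hj0, fun h ↦ ?_⟩
  have h2 := ih.1
  have h3 := ih.2 (by linarith)
  have h4 := h1 j hj (by linarith)
  linarith

/-- A dominant region with ceilings `M` of height `r` lies just below a face point. -/
lemma exists_isFacePoint_of_ceiling [FiniteDimensional ℝ V] [P.IsCrystallographic] [P.IsReduced]
    (hP : P.IsEuclidean) (hR : b.IsDominantCatalanRegion k R) (hr : 1 ≤ r) (hrk : r ≤ k)
    (hM : ∀ i ∈ M, b.IsPos i)
    (hce : ∀ i ∈ M, P.IsCatalanCeiling k R (P.affineHyperplane i r)) :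
    ∃ y, b.IsFacePoint k r M y ∧ R = b.lowerCell k y := by
  obtain ⟨u, hu1⟩ := b.exists_inner_root_eq 1
  have hu : ∀ i, b.IsPos i → 0 < ⟪u, P.root i⟫ := fun i hi ↦
    hi.inner_pos fun j hj ↦ by rw [hu1 j hj]; simp
  obtain ⟨l, hl, hl0, hlk⟩ := exists_recession_vector hR
  have hMl : ∀ i ∈ M, ⟪l, P.root i⟫ = 0 := by
    intro i hi
    by_contra h
    obtain ⟨z, hz⟩ := hR.nonempty
    have h1 := hlk i (hM i hi) (lt_of_le_of_ne (hl0 i (hM i hi)) (Ne.symm h)) z hz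
    have h2 := ((isCatalanCeiling_iff hr hrk).mp (hce i hi)).2 z hz
    have h3 : (r : ℝ) ≤ k := by exact_mod_cast hrk
    linarith
  have := Fintype.ofFinite M
  obtain ⟨hli, y₀, hyM, hy⟩ := (isCofilter_ceilingRoots (l := l) hu hR).exists_face_point (k := k)
    (B := fun v ↦ k * ⟪u, v⟫) (m := fun i : M ↦ (-P.root i, (r : ℤ)))
    (hP.isRootSet l) (fun v hv ↦ by
      rw [inner_neg_left]; exact neg_ne_zero.mpr (inner_ne_zero_of_pos hu hv.1))
    hR.isOpen hR.nonempty
    (fun x hx v hv hpos ↦ by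
      obtain ⟨i, hi, e⟩ := exists_isPos_of_inner_pos hu (P.neg_mem_range_root_iff.mpr hv.1)
        (by simpa using hpos)
      have := inner_le_of_mem_truncation hu1 hl hl0 hx hi
        (by rw [e, inner_neg_right, hv.2, neg_zero])
      rw [e, inner_neg_right, inner_neg_right] at this
      linarith)
    (fun f hf hk hpos ↦ ⟨hf, f.2, le_rfl, (le_abs_self _).trans hk, hpos⟩)
    (fun x hx f hf ↦ by
      obtain ⟨hf, n, h1, h2, h3⟩ := hf
      obtain ⟨z, hz⟩ := hR.nonempty
      have h4 := h3 z hz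
      have h5 := inner_neg_of_mem_halfSpace hu hR hf hz
      rw [eval_apply] at h4
      simp only at h4
      have hn : 0 < n := by
        have : (0 : ℝ) < n := by linarith
        exact_mod_cast this
      have h6 := hx (f.1, n) hf.1 (by rw [abs_of_pos hn]; exact h2) h3
      have h1' : (n : ℝ) ≤ f.2 := by exact_mod_cast h1
      rw [eval_apply] at h6 ⊢
      simp only at h6
      linarith)
    (fun i ↦ isWallRoot_ceilingRoots hP hu hR hr hrk (hM i i.2) (hMl i i.2) (hce i i.2))
    (fun i j h ↦ Subtype.ext (P.root.injective (neg_injective (congrArg Prod.fst h))))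
  have hli' : LinearIndepOn ℝ P.root M := by
    have e : (fun i : M ↦ P.root i) = -fun i : M ↦ -P.root i := by ext; simp
    rw [LinearIndepOn, e]
    exact hli.neg
  rw [← Set.image_eq_range (fun i ↦ ((-P.root i, (r : ℤ)) : V × ℤ)) M] at hy
  have hcl : ∀ f ∈ AddSubmonoid.closure ((fun i ↦ ((-P.root i, (r : ℤ)) : V × ℤ)) '' M),
      ⟪u, f.1⟫ ≤ 0 ∧
        -f ∈ AddSubmonoid.closure ((fun i ↦ ((P.root i, -(r : ℤ)) : V × ℤ)) '' M) := by
    intro f hf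
    induction hf using AddSubmonoid.closure_induction with
    | mem f hf =>
      obtain ⟨i, hi, rfl⟩ := hf
      refine ⟨by simpa using (hu i (hM i hi)).le, AddSubmonoid.subset_closure ⟨i, hi, ?_⟩⟩
      ext <;> simp
    | zero => simp
    | add f g _ _ ihf ihg =>
      rw [Prod.fst_add, inner_add_right, neg_add]
      exact ⟨add_nonpos ihf.1 ihg.1, add_mem ihf.2 ihg.2⟩
  -- Moving along `l` leaves the pairings with roots orthogonal to `l` unchanged and pushes the
  -- other positive roots beyond `k`, where they already are on `R`.
  obtain ⟨s, hs⟩ : ∃ s : ℝ, ∀ i, b.IsPos i → 0 < ⟪l, P.root i⟫ →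
      (k : ℝ) < ⟪y₀ + s • l, P.root i⟫ := by
    have : ∀ᶠ s : ℝ in Filter.atTop, ∀ i, b.IsPos i → 0 < ⟪l, P.root i⟫ →
        (k : ℝ) < ⟪y₀ + s • l, P.root i⟫ := by
      rw [Filter.eventually_all]
      intro i
      rw [Filter.eventually_imp_distrib_left]
      intro _
      rw [Filter.eventually_imp_distrib_left]
      intro h
      filter_upwards [Filter.eventually_gt_atTop ((k - ⟪y₀, P.root i⟫) / ⟪l, P.root i⟫)] with s hs
      rw [div_lt_iff₀ h] at hs
      rw [inner_add_left, inner_smul_left, conj_trivial]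
      linarith
    exact this.exists
  set y := y₀ + s • l with hydef
  have hyl : ∀ i, ⟪l, P.root i⟫ = 0 → ⟪y, P.root i⟫ = ⟪y₀, P.root i⟫ := by
    intro i h
    rw [hydef, inner_add_left, inner_smul_left, h, mul_zero, add_zero]
  have hcast : ∀ {j : ℕ}, j ≤ k → (j : ℝ) ≤ k := fun h ↦ by exact_mod_cast h
  have hgt : ∀ i, b.IsPos i → ∀ j ≤ k, (∀ z ∈ R, (j : ℝ) < ⟪z, P.root i⟫) →
      (j : ℝ) < ⟪y, P.root i⟫ := by
    intro i hi j hj h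
    rcases eq_or_lt_of_le (hl0 i hi) with h0 | h0
    · have := hy (P.root i, -(j : ℤ)) ⟨⟨i, rfl⟩, h0.symm⟩ (by simpa using hj)
        fun z hz ↦ by rw [eval_apply]; push_cast; linarith [h z hz]
      rw [eval_apply] at this
      push_cast at this
      rw [hyl i h0.symm]
      refine lt_of_le_of_ne (by linarith [this.1]) fun e ↦ ?_
      have h1 := (hcl _ (this.2 (by linarith))).1
      exact h1.not_gt (hu i hi)
    · exact (hcast hj).trans_lt (hs i hi h0)
  have hle : ∀ i, b.IsPos i → ∀ j ≤ k, (∀ z ∈ R, ⟪z, P.root i⟫ < j) →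
      ⟪y, P.root i⟫ ≤ j ∧ (⟪y, P.root i⟫ = (j : ℝ) → ((P.root i, -(j : ℤ)) : V × ℤ) ∈
        AddSubmonoid.closure ((fun i ↦ (P.root i, -(r : ℤ))) '' M)) := by
    intro i hi j hj h
    have h0 : ⟪l, P.root i⟫ = 0 := by
      by_contra h0
      obtain ⟨z, hz⟩ := hR.nonempty
      have h1 := hlk i hi (lt_of_le_of_ne (hl0 i hi) (Ne.symm h0)) z hz
      linarith [h z hz, hcast hj]
    have := hy (-P.root i, (j : ℤ)) ⟨P.neg_mem_range_root_iff.mpr ⟨i, rfl⟩, by simpa using h0⟩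
      (by simpa using hj)
      fun z hz ↦ by rw [eval_apply, inner_neg_right]; push_cast; linarith [h z hz]
    rw [eval_apply, inner_neg_right] at this
    push_cast at this
    rw [hyl i h0]
    refine ⟨by linarith [this.1], fun e ↦ ?_⟩
    simpa using (hcl _ (this.2 (by linarith))).2
  refine ⟨y, ⟨hM, hli', fun i hi ↦ ?_, fun i hi ↦ ?_, fun i hi j hj e ↦ ?_⟩,
    hR.eq_cell hgt fun i hi j hj h ↦ (hle i hi j hj h).1.not_gt⟩
  · have := hyM ⟨i, hi⟩
    rw [eval_apply, inner_neg_right] at this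
    push_cast at this
    rw [hyl i (hMl i hi)]
    linarith
  · simpa using hgt i hi 0 (by lia) fun z hz ↦ by simpa using hR.2 i hi z hz
  · rcases hR.forall_lt_or_forall_gt hi hj with h | h
    · exact absurd e (hgt i hi j hj h).ne'
    · exact (hle i hi j hj h).2 e

end Base

end RootPairing

/-! ### Counting regions by their sets of floors and ceilings. -/

/-- Both images are the quotient of `s` by the same equivalence relation. -/
lemma Set.encard_image_eq_of_eq_iff_eq {α β γ : Type*} {f : α → β} {g : α → γ} {s : Set α}
    (h : ∀ a ∈ s, ∀ a' ∈ s, f a = f a' ↔ g a = g a') : (f '' s).encard = (g '' s).encard := by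
  rcases s.eq_empty_or_nonempty with rfl | ⟨a₀, ha₀⟩
  · simp
  have : Nonempty α := ⟨a₀⟩
  have hinv : ∀ a ∈ s, Function.invFunOn f s (f a) ∈ s ∧ f (Function.invFunOn f s (f a)) = f a :=
    fun a ha ↦ ⟨Function.invFunOn_mem ⟨a, ha, rfl⟩, Function.invFunOn_eq ⟨a, ha, rfl⟩⟩
  have hg : ∀ a ∈ s, g (Function.invFunOn f s (f a)) = g a :=
    fun a ha ↦ (h _ (hinv a ha).1 a ha).mp (hinv a ha).2
  have hinj : Set.InjOn (fun z ↦ g (Function.invFunOn f s z)) (f '' s) := by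
    rintro _ ⟨a, ha, rfl⟩ _ ⟨a', ha', rfl⟩ e
    simp only [hg a ha, hg a' ha'] at e
    exact (h a ha a' ha').mpr e
  rw [← hinj.encard_image, Set.image_image]
  exact congrArg _ (Set.image_congr hg)

/-- Two families of finite sets that contain each finite set equally often have the same
distribution of cardinalities. -/
lemma Finset.card_filter_card_eq_of_card_filter_subset {α ι : Type*} [Fintype ι] [DecidableEq ι]
    (D : Finset α) (F G : α → Finset ι)
    (h : ∀ M : Finset ι, (D.filter fun a ↦ M ⊆ F a).card = (D.filter fun a ↦ M ⊆ G a).card)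
    (l : ℕ) :
    (D.filter fun a ↦ (F a).card = l).card = (D.filter fun a ↦ (G a).card = l).card := by
  have hsub : ∀ (F : α → Finset ι) (M : Finset ι), (D.filter fun a ↦ M ⊆ F a).card =
      (D.filter fun a ↦ F a = M).card +
        ∑ N ∈ Finset.univ.filter (M ⊂ ·), (D.filter fun a ↦ F a = N).card := by
    intro F M
    have h1 : (D.filter fun a ↦ M ⊆ F a).card =
        ∑ N ∈ Finset.univ.filter (M ⊆ ·), (D.filter fun a ↦ F a = N).card := by
      rw [Finset.card_eq_sum_card_fiberwise (f := F) (t := Finset.univ.filter (M ⊆ ·))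
        (fun a ha ↦ by simpa using (Finset.mem_filter.mp ha).2)]
      refine Finset.sum_congr rfl fun N hN ↦ congrArg _ ?_
      rw [Finset.filter_filter]
      refine Finset.filter_congr fun a _ ↦ ⟨fun h ↦ h.2, fun h ↦ ⟨?_, h⟩⟩
      rw [h]
      exact (Finset.mem_filter.mp hN).2
    have h2 : Finset.univ.filter (M ⊆ ·) = insert M (Finset.univ.filter (M ⊂ ·)) := by
      ext N
      simp only [Finset.mem_filter, Finset.mem_univ, true_and, Finset.mem_insert]
      exact ⟨fun h ↦ (eq_or_ssubset_of_subset h).imp_left Eq.symm,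
        fun h ↦ h.elim (fun e ↦ e ▸ Finset.Subset.refl _) (·.subset)⟩
    rw [h1, h2, Finset.sum_insert (by simp)]
  have heq : ∀ M : Finset ι,
      (D.filter fun a ↦ F a = M).card = (D.filter fun a ↦ G a = M).card := by
    intro M
    -- Möbius inversion: the exact count at `M` is the superset count minus the exact counts at
    -- strictly larger sets, already known to agree.
    induction M using Finset.strongDownwardInduction (n := Fintype.card ι) with
    | H M ih =>
      have h1 := hsub F M
      rw [h M, hsub G M] at h1
      have h2 : ∑ N ∈ Finset.univ.filter (M ⊂ ·), (D.filter fun a ↦ F a = N).card =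
          ∑ N ∈ Finset.univ.filter (M ⊂ ·), (D.filter fun a ↦ G a = N).card :=
        Finset.sum_congr rfl fun N hN ↦ ih N.card_le_univ (Finset.mem_filter.mp hN).2
      lia
    | _ => exact M.card_le_univ
  have hsum : ∀ F : α → Finset ι, (D.filter fun a ↦ (F a).card = l).card =
      ∑ N ∈ Finset.univ.filter (fun N : Finset ι ↦ N.card = l),
        (D.filter fun a ↦ F a = N).card := by
    intro F
    rw [Finset.card_eq_sum_card_fiberwise (f := F)
      (t := Finset.univ.filter (fun N : Finset ι ↦ N.card = l))
      (fun a ha ↦ by simpa using (Finset.mem_filter.mp ha).2)]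
    refine Finset.sum_congr rfl fun N hN ↦ congrArg _ ?_
    rw [Finset.filter_filter]
    refine Finset.filter_congr fun a _ ↦ ⟨fun h ↦ h.2, fun h ↦ ⟨?_, h⟩⟩
    rw [h]
    exact (Finset.mem_filter.mp hN).2
  rw [hsum, hsum]
  exact Finset.sum_congr rfl fun N _ ↦ heq N

namespace RootPairing.Base

variable {ι V : Type*} [NormedAddCommGroup V] [InnerProductSpace ℝ V] {P : RootPairing ι ℝ V V}
  {b : P.Base} {k r : ℕ}

/-- There are as many dominant regions with floors `M` of height `r` as with ceilings `M`. -/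
lemma encard_floor_eq_encard_ceiling [Finite ι] [FiniteDimensional ℝ V] [P.IsCrystallographic]
    [P.IsReduced] (hP : P.IsEuclidean) (hr : 1 ≤ r) (hrk : r ≤ k) (M : Set ι) :
    {R | b.IsDominantCatalanRegion k R ∧
      ∀ i ∈ M, b.IsPos i ∧ P.IsCatalanFloor k R (P.affineHyperplane i r)}.encard =
    {R | b.IsDominantCatalanRegion k R ∧
      ∀ i ∈ M, b.IsPos i ∧ P.IsCatalanCeiling k R (P.affineHyperplane i r)}.encard := by
  have hU : {R | b.IsDominantCatalanRegion k R ∧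
      ∀ i ∈ M, b.IsPos i ∧ P.IsCatalanFloor k R (P.affineHyperplane i r)} =
      b.upperCell k '' {y | b.IsFacePoint k r M y} := by
    ext R
    constructor
    · rintro ⟨hR, h⟩
      obtain ⟨y, hy, rfl⟩ := exists_isFacePoint_of_floor hP hR hr hrk (fun i hi ↦ (h i hi).1)
        fun i hi ↦ (h i hi).2
      exact ⟨y, hy, rfl⟩
    · rintro ⟨y, hy, rfl⟩
      exact ⟨hy.isDominantCatalanRegion_upperCell,
        fun i hi ↦ ⟨hy.isPos i hi, hy.isCatalanFloor_upperCell hr hrk hi⟩⟩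
  have hL : {R | b.IsDominantCatalanRegion k R ∧
      ∀ i ∈ M, b.IsPos i ∧ P.IsCatalanCeiling k R (P.affineHyperplane i r)} =
      b.lowerCell k '' {y | b.IsFacePoint k r M y} := by
    ext R
    constructor
    · rintro ⟨hR, h⟩
      obtain ⟨y, hy, rfl⟩ := exists_isFacePoint_of_ceiling hP hR hr hrk (fun i hi ↦ (h i hi).1)
        fun i hi ↦ (h i hi).2
      exact ⟨y, hy, rfl⟩
    · rintro ⟨y, hy, rfl⟩
      exact ⟨hy.isDominantCatalanRegion_lowerCell,
        fun i hi ↦ ⟨hy.isPos i hi, hy.isCatalanCeiling_lowerCell hr hrk hi⟩⟩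
  rw [hU, hL]
  exact Set.encard_image_eq_of_eq_iff_eq fun y hy y' hy' ↦ hy.upperCell_eq_iff hy'

lemma encard_hasHeight (hr : 1 ≤ r) (p : AffineSubspace ℝ V → Prop) :
    {H | p H ∧ b.HasHeight r H}.encard =
      {i | b.IsPos i ∧ p (P.affineHyperplane i r)}.encard := by
  rw [← Set.InjOn.encard_image (f := fun i ↦ P.affineHyperplane i r)
    fun i _ j _ h ↦ affineHyperplane_injective hr h]
  congr 1
  ext H
  constructor
  · rintro ⟨h, i, hi, rfl⟩
    exact ⟨i, ⟨hi, h⟩, rfl⟩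
  · rintro ⟨i, ⟨hi, h⟩, rfl⟩
    exact ⟨h, i, hi, rfl⟩

end RootPairing.Base

theorem corollary2 {ι V : Type*} [Finite ι]
    [NormedAddCommGroup V] [InnerProductSpace ℝ V] [FiniteDimensional ℝ V]
    (P : RootPairing ι ℝ V V) (hP : P.IsEuclidean)
    [P.IsRootSystem] [P.IsCrystallographic] [P.IsReduced] (b : P.Base)
    (k r l : ℕ) (hr : 1 ≤ r) (hrk : r ≤ k) (hl : l ≤ Module.finrank ℝ V) :
    b.flCount k r l = b.clCount k r l := by
  classical
  have := Fintype.ofFinite ι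
  let D := (b.finite_isDominantCatalanRegion k).toFinset
  let F : Set V → Finset ι := fun R ↦
    Finset.univ.filter fun i ↦ b.IsPos i ∧ P.IsCatalanFloor k R (P.affineHyperplane i r)
  let G : Set V → Finset ι := fun R ↦
    Finset.univ.filter fun i ↦ b.IsPos i ∧ P.IsCatalanCeiling k R (P.affineHyperplane i r)
  have hfl : b.flCount k r l = (D.filter fun R ↦ (F R).card = l).card := by
    rw [RootPairing.Base.flCount, ← Set.encard_coe_eq_coe_finsetCard]
    congr 1
    ext R
    simp only [RootPairing.Base.encard_hasHeight hr, Set.mem_ofPred_eq, Finset.coe_filter, D,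
      Set.Finite.mem_toFinset]
    rw [show {i | b.IsPos i ∧ P.IsCatalanFloor k R (P.affineHyperplane i r)} = (F R : Set ι) by
      simp [F], Set.encard_coe_eq_coe_finsetCard, Nat.cast_inj]
  have hcl : b.clCount k r l = (D.filter fun R ↦ (G R).card = l).card := by
    rw [RootPairing.Base.clCount, ← Set.encard_coe_eq_coe_finsetCard]
    congr 1
    ext R
    simp only [RootPairing.Base.encard_hasHeight hr, Set.mem_ofPred_eq, Finset.coe_filter, D,
      Set.Finite.mem_toFinset]
    rw [show {i | b.IsPos i ∧ P.IsCatalanCeiling k R (P.affineHyperplane i r)} = (G R : Set ι) by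
      simp [G], Set.encard_coe_eq_coe_finsetCard, Nat.cast_inj]
  rw [hfl, hcl, Nat.cast_inj]
  refine Finset.card_filter_card_eq_of_card_filter_subset D F G (fun M ↦ ?_) l
  have h := RootPairing.Base.encard_floor_eq_encard_ceiling (b := b) hP hr hrk (M : Set ι)
  rw [← Nat.cast_inj (R := ℕ∞), ← Set.encard_coe_eq_coe_finsetCard,
    ← Set.encard_coe_eq_coe_finsetCard]
  convert h using 2
  · ext R
    simp [D, F, Finset.subset_iff]
  · ext R
    simp [D, G, Finset.subset_iff]
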